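/- Let $N\ge 0$, let $\lambda_1,\dots,\lambda_N\in\mathbb C$ be distinct with $\lambda_i-\lambda_j\neq 1$ for $i\neq j$, let $\mu_1,\dots,\mu_N\in\mathbb C\setminus\{0\}$, and let $R>0$ be such that $|\lambda_i|<R$ and $|\lambda_i-1|<R$ for all $i$. Let $H=L^2(S)$, where $S=\{|z|=R\}$, and let $H_+$ (resp. $H_-$) be the subspace of functions whose Fourier series involves only non-negative (resp. negative) powers of $z$. Let $\mathrm{Gr}$ be the set of closed subspaces $W\subset H$ for which the projection $W\to H_+$ is Fredholm of index $0$ and the projection $W\to H_-$ is compact. Let $W^{\rm alg}_{\lambda,\mu}$ be the space of rational functions $f$ that are regular except for at most simple poles at $\lambda_1,\dots,\lambda_N$ and a pole of any order at $\infty$, and that satisfy $$\operatorname{res}_{\lambda_i}f+\mu_i^2f(\lambda_i-1)=0,\qquad 1\le i\le N,$$ and let $W=W_{\lambda,\mu}$ be its closure in $H$. Consider times $t=(t_1,t_2,\dots)$ with $\sum_k|t_k|\rho^k<\infty$ for some $\rho>R$, and put $\exp(t,z)=\exp\bigl(\sum_{k\ge1}t_kz^k\bigr)$. If the projection $\exp(t,z)^{-1}W\to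 H_+$ is an isomorphism, the reduced Baker--Akhiezer function $\tilde\psi_W(t,z)$ is the unique element of $\exp(t,z)^{-1}W$ that projects onto $1$; it extends to $|z|>R$ by its series in powers of $z^{-1}$. A tau function of $W$ is a function $\tau_W$, holomorphic in the times (that is, on each weighted $\ell^1$ space $\sum_k|t_k|\rho^k<\infty$, $\rho>R$), such that for all these $t$ one has $\tau_W(t)\ne0$ and Sato's formula $$\tilde\psi_W(t,z)=\frac{\tau_W\bigl(t_1-\frac1z,\,t_2-\frac1{2z^2},\,t_3-\frac1{3z^3},\dots\bigr)}{\tau_W(t_1,t_2,t_3,\dots)},\qquad |z|>R.$$ Let $X$ and $Z$ be the $N\times N$ matrices $X_{ij}=\dfrac{\mu_i\mu_j}{1+\lambda_j-\lambda_i}$ and $Z=\operatorname{diag}(\lambda_1,\dots,\lambda_N)$. Then $W\in\mathrm{Gr}$, and the tau functions of $W$ are exactly the non-zero constant multiples of $$\tau_W(t_1,t_2,t_3,\dots)=\det\Bigl\{I-X\exp\Bigl(\sum_{k=1}^{\infty}t_k\bigl((Z-I)^k-Z^k\bigr)\Bigr)\Bigr\}.$$ -/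

import Mathlib

open MeasureTheory

noncomputable section

namespace SegalWilson

/-- The Hilbert space `H = L²(S)` of the circle `S = {z : |z| = R}`. The circle is parametrised by
`θ ∈ ℝ/ℤ` through `z = R e^{2πiθ}` (see `circlePt`) and carries the rotation invariant probability
measure. -/
abbrev H : Type := Lp ℂ 2 (@AddCircle.haarAddCircle 1 _)

/-- The point `z = R e^{2πiθ}` of the circle of radius `R`. -/
def circlePt (R : ℝ) (θ : UnitAddCircle) : ℂ := (R : ℂ) * fourier 1 θ

/-- The closed subspace of the functions whose Fourier coefficients vanish off `S`, that is, whose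
Fourier series involves only the powers `z ^ n` with `n ∈ S`. -/
def spectralSubspace (S : Set ℤ) : Submodule ℂ H where
  carrier := {f | ∀ n, n ∉ S → fourierCoeff (f : UnitAddCircle → ℂ) n = 0}
  zero_mem' := by
    intro n _
    rw [← fourierBasis_repr]
    simp
  add_mem' := by
    intro f g hf hg n hn
    have h1 := hf n hn
    have h2 := hg n hn
    rw [← fourierBasis_repr] at h1 h2 ⊢
    simp [h1, h2]
  smul_mem' := by
    intro c f hf n hn
    have h1 := hf n hn
    rw [← fourierBasis_repr] at h1 ⊢
    simp [h1]

theorem isClosed_spectralSubspace (S : Set ℤ) :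
    IsClosed (spectralSubspace S : Set H) := by
  have h : (spectralSubspace S : Set H) =
      ⋂ n ∈ Sᶜ, {f : H | inner ℂ (fourierBasis n : H) f = 0} := by
    ext f
    simp only [SetLike.mem_coe, Set.mem_iInter, Set.mem_ofPred_eq, Set.mem_compl_iff]
    refine forall_congr' fun n => forall_congr' fun _ => ?_
    rw [← fourierBasis_repr, HilbertBasis.repr_apply_apply]
  rw [h]
  exact isClosed_biInter fun n _ =>
    isClosed_eq (continuous_const.inner continuous_id) continuous_const

instance (S : Set ℤ) : CompleteSpace (spectralSubspace S) :=
  (isClosed_spectralSubspace S).completeSpace_coe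

/-- `H₊`: only non-negative powers of `z`. -/
def HPlus : Submodule ℂ H := spectralSubspace {n | 0 ≤ n}

/-- `H₋`: only negative powers of `z`. -/
def HMinus : Submodule ℂ H := spectralSubspace {n | n < 0}

instance : CompleteSpace HPlus := inferInstanceAs (CompleteSpace (spectralSubspace _))

instance : CompleteSpace HMinus := inferInstanceAs (CompleteSpace (spectralSubspace _))

/-- The orthogonal projection `W → H₊`. -/
def projPlus (W : Submodule ℂ H) : W →L[ℂ] HPlus :=
  HPlus.orthogonalProjectionOnto ∘L W.subtypeL

/-- The orthogonal projection `W → H₋`. -/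
def projMinus (W : Submodule ℂ H) : W →L[ℂ] HMinus :=
  HMinus.orthogonalProjectionOnto ∘L W.subtypeL

/-- The Grassmannian `Gr` of all closed subspaces `W` of `H` such that the projection `W → H₊` is
Fredholm of index zero and the projection `W → H₋` is compact. -/
structure MemGr (W : Submodule ℂ H) : Prop where
  isClosed : IsClosed (W : Set H)
  fredholm : (projPlus W).IsFredholm
  index_zero : Module.finrank ℂ (projPlus W).ker = Module.finrank ℂ (HPlus ⧸ (projPlus W).range)
  compact : IsCompactOperator (projMinus W)

/-- The times `t = (t₁, t₂, …)` for which `∑ tₖ zᵏ` converges on a neighbourhood of the closed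
disc `|z| ≤ R`. -/
def Times (R : ℝ) : Set (ℕ+ → ℂ) :=
  {t | ∃ ρ : ℝ, R < ρ ∧ Summable fun k : ℕ+ => ‖t k‖ * ρ ^ (k : ℕ)}

/-- `exp(t, z) = exp (∑ tₖ zᵏ)`. -/
def expFlow (t : ℕ+ → ℂ) (z : ℂ) : ℂ := Complex.exp (∑' k : ℕ+, t k * z ^ (k : ℕ))

/-- The space `exp⁻¹(t, z) W`. -/
def flow (R : ℝ) (t : ℕ+ → ℂ) (W : Submodule ℂ H) : Submodule ℂ H where
  carrier := {g | ∃ f ∈ W, (g : UnitAddCircle → ℂ) =ᵐ[AddCircle.haarAddCircle]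
    fun θ => (expFlow t (circlePt R θ))⁻¹ * f θ}
  zero_mem' := by
    refine ⟨0, W.zero_mem, ?_⟩
    filter_upwards with θ
    simp
  add_mem' := by
    rintro g₁ g₂ ⟨f₁, h₁, e₁⟩ ⟨f₂, h₂, e₂⟩
    refine ⟨f₁ + f₂, W.add_mem h₁ h₂, ?_⟩
    filter_upwards [e₁, e₂, Lp.coeFn_add g₁ g₂, Lp.coeFn_add f₁ f₂] with θ a b c d
    rw [c, d, Pi.add_apply, Pi.add_apply, a, b]
    ring
  smul_mem' := by
    rintro c g ⟨f, h, e⟩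
    refine ⟨c • f, W.smul_mem c h, ?_⟩
    filter_upwards [e, Lp.coeFn_smul c g, Lp.coeFn_smul c f] with θ a b d
    rw [b, d, Pi.smul_apply, Pi.smul_apply, a, smul_eq_mul, smul_eq_mul]
    ring

/-- `W` is transverse to `H₋`: the projection `W → H₊` is an isomorphism (a bijective bounded
operator). -/
def Transverse (W : Submodule ℂ H) : Prop := Function.Bijective (projPlus W)

/-- `f = ψ̃_W(t, ·)` is the reduced Baker–Akhiezer function of `W` at time `t`: an element of
`exp⁻¹(t, z) W` that projects onto the constant function `1 ∈ H₊`. It is unique if `exp⁻¹(t, z) W`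
is transverse. -/
def IsReducedBakerAkhiezer (R : ℝ) (W : Submodule ℂ H) (t : ℕ+ → ℂ) (f : H) : Prop :=
  f ∈ flow R t W ∧ ((HPlus.orthogonalProjectionOnto f : HPlus) : H) = fourierLp 2 0

/-- The value at a point `z` with `|z| > R` of a function on the circle `|z| = R` whose Fourier
series involves only the powers `z⁰, z⁻¹, z⁻², …`. The power `z ^ (-n)` restricts to
`R ^ (-n) e^{-2πinθ}` on the circle. -/
def outerValue (R : ℝ) (f : H) (z : ℂ) : ℂ :=
  ∑' n : ℕ, fourierCoeff (f : UnitAddCircle → ℂ) (-(n : ℤ)) * ((R : ℂ) / z) ^ n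

/-- The shifted times `(t₁ - 1/z, t₂ - 1/(2z²), t₃ - 1/(3z³), …)`. -/
def shift (t : ℕ+ → ℂ) (z : ℂ) : ℕ+ → ℂ := fun k => t k - 1 / ((k : ℂ) * z ^ (k : ℕ))

/-- `τ` is a tau function of `W`: it is holomorphic in the times, and Sato's formula
`ψ̃_W(t, z) = τ(t₁ - 1/z, t₂ - 1/(2z²), …) / τ(t₁, t₂, …)` for `|z| > R` holds at every time `t` at
which the Baker–Akhiezer function is defined. Holomorphic means complex differentiable on each of
the weighted `ℓ¹` spaces `∑ |tₖ| ρᵏ < ∞`, `ρ > R`, whose union is `Times R`; here `(aₖ) ∈ ℓ¹`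
stands for `tₖ = aₖ ρ⁻ᵏ`. -/
structure IsTauFunction (R : ℝ) (W : Submodule ℂ H) (τ : (ℕ+ → ℂ) → ℂ) : Prop where
  holomorphic : ∀ ρ : ℝ, R < ρ →
    Differentiable ℂ fun a : lp (fun _ : ℕ+ => ℂ) 1 => τ fun k => a k / (ρ : ℂ) ^ (k : ℕ)
  sato : ∀ t ∈ Times R, Transverse (flow R t W) →
    τ t ≠ 0 ∧ ∀ f : H, IsReducedBakerAkhiezer R W t f →
      ∀ z : ℂ, R < ‖z‖ → outerValue R f z = τ (shift t z) / τ t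

/-- The rational function `f` has no pole at `w ∈ ℂ`. -/
def RegularAt (f : RatFunc ℂ) (w : ℂ) : Prop := f.denom.eval w ≠ 0

/-- The residue `((z - w) f(z))|_{z = w}` at `w` of a rational function with at most a simple pole
there. -/
def simpleResidue (f : RatFunc ℂ) (w : ℂ) : ℂ :=
  ((RatFunc.X - RatFunc.C w) * f).eval (RingHom.id ℂ) w

variable {N : ℕ}

/-- The space `W^alg_{λ,μ}` of rational functions `f`, regular except for at most simple poles at
`λ₁, …, λ_N` and poles of any order at infinity, with `res_{λᵢ} f + μᵢ² f(λᵢ - 1) = 0` for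
all `i`. -/
def WAlg (l m : Fin N → ℂ) : Set (RatFunc ℂ) :=
  {f | (∀ w : ℂ, (∀ i, w ≠ l i) → RegularAt f w) ∧
    (∀ i, RegularAt ((RatFunc.X - RatFunc.C (l i)) * f) (l i)) ∧
    ∀ i, simpleResidue f (l i) + m i ^ 2 * f.eval (RingHom.id ℂ) (l i - 1) = 0}

/-- The space `W_{λ,μ}`: the closure in `H` of the restrictions to the circle `|z| = R` of the
elements of `W^alg_{λ,μ}`. (These restrictions already form a linear subspace.) -/
def WSpace (R : ℝ) (l m : Fin N → ℂ) : Submodule ℂ H :=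
  (Submodule.span ℂ {g : H | ∃ f ∈ WAlg l m, (g : UnitAddCircle → ℂ) =ᵐ[AddCircle.haarAddCircle]
    fun θ => f.eval (RingHom.id ℂ) (circlePt R θ)}).topologicalClosure

/-- The matrix `X` with entries `μᵢ μⱼ / (1 + λⱼ - λᵢ)`. -/
def matX (l m : Fin N → ℂ) : Matrix (Fin N) (Fin N) ℂ :=
  Matrix.of fun i j => m i * m j / (1 + l j - l i)

/-- The matrix `Z = diag(λ₁, …, λ_N)`. -/
def matZ (l : Fin N → ℂ) : Matrix (Fin N) (Fin N) ℂ := Matrix.diagonal l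

end SegalWilson

end

/-!
The proof rests on an explicit description of `W` that
is stable under the flow.

For parameters `ν₁, …, ν_N` let `polarSpace R l ν` be the space of functions
`f = p + ∑ αⱼ / (z - λⱼ)` on the circle with `p ∈ H₊` and `αᵢ + νᵢ f(λᵢ - 1) = 0`. By partial
fractions, and by approximating `p` by polynomials with the same values at the points `λᵢ - 1`, the
space `W` is `polarSpace R l ν` with `νᵢ = μᵢ²` (`WSpace_eq_polarSpace`). Multiplication by a
function `h` that is holomorphic and without zeros near the disc multiplies the residue at `λᵢ` by
`h(λᵢ)` and the value at `λᵢ - 1` by `h(λᵢ - 1)`, so that the flow only changes the parameters: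
`νᵢ` is multiplied by `exp(t, λᵢ - 1) / exp(t, λᵢ)` (`flow_polarSpace`).

Given `p`, the conditions on `α` are a linear system with the square matrix
`bakerMat l ν = 1 - diag(ν) C`, where `Cᵢⱼ = 1 / (1 + λⱼ - λᵢ)`. The kernel and the cokernel of the
projection to `H₊` are those of this matrix, which gives membership in `Gr` (`memGr_polarSpace`),
and transversality means `det (bakerMat l ν) ≠ 0` (`transverse_polarSpace_iff`). This determinant
is the determinant of the theorem (`det_eq_tauDet`). The shift of the times by `z` multiplies `νᵢ`
by `1 + 1 / (z - λᵢ)`, and Sato's formula becomes the identity `det_bakerMat_shift`, which holds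
because, with `Z = diag (λ₁, …, λ_N)`, the matrix `(z - Z + 1) C - C (z - Z)` has all entries `1`
and so has rank one.

For the converse, let `τ` be a tau function and `τ₀` the determinant. Sato's formula shows that
`τ / τ₀` is invariant under the translations by `[u] = (u, u² / 2, u³ / 3, …)`. Differentiating in
`u`, the functional `τ₀ dτ - τ dτ₀` vanishes on all vectors `(1, u, u², …)` with `u` small, hence on
`ℓ¹` (`fderiv_eq_of_bracket`). So `τ` is a multiple of `τ₀` on each complex line through a fixed
point `(s, 0, 0, …)` at which `τ₀` does not vanish (`mul_eq_mul_of_bracket`).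
-/

noncomputable section

namespace SegalWilson

/-! ### Fourier series on the circle -/

theorem continuous_circlePt (R : ℝ) : Continuous (circlePt R) := by
  unfold circlePt
  exact continuous_const.mul (fourier 1).continuous

theorem circlePt_pow (R : ℝ) (n : ℕ) (θ : UnitAddCircle) :
    circlePt R θ ^ n = (R : ℂ) ^ n * fourier n θ := by
  rw [circlePt, mul_pow, fourier_one, fourier_apply, natCast_zsmul, AddCircle.toCircle_nsmul]
  simp

theorem norm_circlePt {R : ℝ} (hR : 0 < R) (θ : UnitAddCircle) : ‖circlePt R θ‖ = R := by
  rw [circlePt, norm_mul, fourier_one, Circle.norm_coe, mul_one, Complex.norm_real,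
    Real.norm_of_nonneg hR.le]

/-- The restriction of `F : ℂ → ℂ` to the circle `|z| = R` as an element of `H`. The value is `0`
if the restriction is not continuous. -/
def bdry (R : ℝ) (F : ℂ → ℂ) : H := by
  classical
  exact if h : Continuous fun θ : UnitAddCircle => F (circlePt R θ) then
    ContinuousMap.toLp (E := ℂ) 2 AddCircle.haarAddCircle ℂ ⟨_, h⟩ else 0

theorem bdry_eq_toLp {R : ℝ} {F : ℂ → ℂ}
    (h : Continuous fun θ : UnitAddCircle => F (circlePt R θ)) :
    bdry R F = ContinuousMap.toLp (E := ℂ) 2 AddCircle.haarAddCircle ℂ ⟨_, h⟩ := by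
  simp [bdry, h]

theorem coeFn_bdry {R : ℝ} {F : ℂ → ℂ}
    (h : Continuous fun θ : UnitAddCircle => F (circlePt R θ)) :
    (bdry R F : UnitAddCircle → ℂ) =ᵐ[AddCircle.haarAddCircle] fun θ => F (circlePt R θ) := by
  rw [bdry_eq_toLp h]
  exact ContinuousMap.coeFn_toLp _ _

theorem eq_bdry {R : ℝ} {F : ℂ → ℂ}
    (h : Continuous fun θ : UnitAddCircle => F (circlePt R θ)) {f : H}
    (hf : (f : UnitAddCircle → ℂ) =ᵐ[AddCircle.haarAddCircle] fun θ => F (circlePt R θ)) :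
    f = bdry R F :=
  Lp.ext (hf.trans (coeFn_bdry h).symm)

theorem continuous_comp_circlePt {R : ℝ} (hR : 0 < R) {F : ℂ → ℂ}
    (h : ContinuousOn F (Metric.sphere 0 R)) :
    Continuous fun θ : UnitAddCircle => F (circlePt R θ) :=
  h.comp_continuous (continuous_circlePt R) fun θ => by simp [norm_circlePt hR]

/-- An absolutely convergent trigonometric series converges in `H` to its pointwise sum. -/
theorem hasSum_bdry {ι : Type*} {R : ℝ} {F : ℂ → ℂ}
    (h : Continuous fun θ : UnitAddCircle => F (circlePt R θ)) {b : ι → ℂ} {e : ι → ℤ}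
    (hb : Summable fun i => ‖b i‖)
    (hF : ∀ θ, HasSum (fun i => b i * fourier (e i) θ) (F (circlePt R θ))) :
    HasSum (fun i => b i • (fourierLp 2 (e i) : H)) (bdry R F) := by
  have hs : Summable fun i => b i • (fourier (e i) : C(UnitAddCircle, ℂ)) := by
    refine Summable.of_norm ?_
    simpa [norm_smul, fourier_norm] using hb
  obtain ⟨g, hg⟩ := hs
  have hgF : g = ⟨_, h⟩ := by
    ext θ
    have := (ContinuousMap.evalCLM ℂ θ).hasSum hg
    exact HasSum.unique (by simpa using this) (hF θ)
  rw [bdry_eq_toLp h, ← hgF]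
  have := (ContinuousMap.toLp (E := ℂ) 2 AddCircle.haarAddCircle ℂ).hasSum hg
  simpa only [Function.comp_def, map_smul] using this

theorem mem_of_hasSum {ι E : Type*} [AddCommGroup E] [Module ℂ E] [TopologicalSpace E]
    {K : Submodule ℂ E} (hK : IsClosed (K : Set E)) {f : ι → E} {x : E} (h : HasSum f x)
    (hf : ∀ i, f i ∈ K) : x ∈ K :=
  hK.mem_of_tendsto h (Filter.Eventually.of_forall fun _ => K.sum_mem fun i _ => hf i)

theorem fourierCoeff_eq_inner (f : H) (n : ℤ) :
    fourierCoeff (f : UnitAddCircle → ℂ) n = inner ℂ (fourierLp 2 n : H) f := by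
  rw [← fourierBasis_repr, HilbertBasis.repr_apply_apply, coe_fourierBasis]

theorem inner_fourierLp (m n : ℤ) :
    inner ℂ (fourierLp 2 m : H) (fourierLp 2 n : H) = if m = n then 1 else 0 :=
  orthonormal_iff_ite.1 orthonormal_fourier m n

theorem fourierLp_mem_spectralSubspace {S : Set ℤ} {n : ℤ} (hn : n ∈ S) :
    (fourierLp 2 n : H) ∈ spectralSubspace S := by
  intro m hm
  rw [fourierCoeff_eq_inner, inner_fourierLp, if_neg]
  rintro rfl
  exact hm hn

theorem hasSum_HPlus {p : H} (hp : p ∈ HPlus) :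
    HasSum (fun n : ℕ => fourierCoeff (p : UnitAddCircle → ℂ) n • (fourierLp 2 (n : ℤ) : H)) p := by
  have h := hasSum_fourier_series_L2 p
  refine (Function.Injective.hasSum_iff (g := fun n : ℕ => (n : ℤ)) Nat.cast_injective ?_).2 h
  intro n hn
  have : fourierCoeff (p : UnitAddCircle → ℂ) n = 0 := by
    refine hp n fun h0 => hn ⟨n.toNat, ?_⟩
    simpa using h0
  rw [this, zero_smul]

/-! ### Evaluation at a point of the disc -/

theorem norm_div_ofReal_lt_one {R : ℝ} {w : ℂ} (hw : ‖w‖ < R) : ‖w / (R : ℂ)‖ < 1 := by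
  have hR : 0 < R := (norm_nonneg w).trans_lt hw
  rw [norm_div, Complex.norm_real, Real.norm_of_nonneg hR.le]
  exact (div_lt_one hR).2 hw

/-- The Szegő kernel of the disc `|z| < R` at the point `w`. -/
def szego (R : ℝ) (w : ℂ) : H :=
  ∑' n : ℕ, (starRingEnd ℂ (w / R)) ^ n • (fourierLp 2 (n : ℤ) : H)

/-- Evaluation at the point `w` of the disc `|z| < R` of the part of `f` that has only
non-negative powers of `z`. -/
def evalAt (R : ℝ) (w : ℂ) : H →L[ℂ] ℂ := innerSL ℂ (szego R w)

theorem hasSum_szego {R : ℝ} {w : ℂ} (hw : ‖w‖ < R) :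
    HasSum (fun n : ℕ => (starRingEnd ℂ (w / R)) ^ n • (fourierLp 2 (n : ℤ) : H)) (szego R w) := by
  refine Summable.hasSum (Summable.of_norm ?_)
  have h1 : ∀ n : ℕ, ‖(fourierLp 2 (n : ℤ) : H)‖ = 1 := fun n =>
    orthonormal_fourier.norm_eq_one _
  simp only [norm_smul, h1, mul_one, norm_pow, RCLike.norm_conj]
  exact summable_geometric_of_lt_one (norm_nonneg _) (norm_div_ofReal_lt_one hw)

theorem evalAt_fourierLp {R : ℝ} {w : ℂ} (hw : ‖w‖ < R) (m : ℤ) :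
    evalAt R w (fourierLp 2 m : H) = if 0 ≤ m then (w / R) ^ m.toNat else 0 := by
  have h := (innerSL ℂ (fourierLp 2 m : H)).hasSum (hasSum_szego hw)
  simp only [map_smul, innerSL_apply_apply, inner_fourierLp, smul_eq_mul] at h
  rw [evalAt, innerSL_apply_apply, ← inner_conj_symm]
  split_ifs with hm
  · obtain ⟨k, rfl⟩ := Int.eq_ofNat_of_zero_le hm
    have h2 := hasSum_single (f := fun n : ℕ => (starRingEnd ℂ (w / R)) ^ n *
      if (k : ℤ) = (n : ℤ) then (1 : ℂ) else 0) k (fun b hb => by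
        have : (k : ℤ) ≠ b := fun h => hb (by exact_mod_cast h.symm)
        simp [this])
    rw [h.unique h2]
    simp
  · have h2 : (fun n : ℕ => (starRingEnd ℂ (w / R)) ^ n *
      if m = (n : ℤ) then (1 : ℂ) else 0) = fun _ => 0 := by
      funext n
      rw [if_neg (by omega), mul_zero]
    rw [h2] at h
    rw [h.unique hasSum_zero, map_zero]

/-! ### Functions holomorphic on a neighbourhood of the disc -/

theorem continuous_comp_of_differentiableOn {R ρ : ℝ} (hR : 0 < R) (hρ : R < ρ) {F : ℂ → ℂ}
    (hF : DifferentiableOn ℂ F (Metric.ball 0 ρ)) :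
    Continuous fun θ : UnitAddCircle => F (circlePt R θ) :=
  continuous_comp_circlePt hR (hF.continuousOn.mono fun z hz => by
    rw [mem_sphere_zero_iff_norm] at hz
    rw [mem_ball_zero_iff, hz]
    exact hρ)

/-- A function that is holomorphic on a neighbourhood of the disc `|z| ≤ R` restricts to an element
of `H₊`, and `evalAt` returns its values inside the disc. -/
theorem bdry_mem_HPlus_and_evalAt {R ρ : ℝ} (hR : 0 < R) (hρ : R < ρ) {F : ℂ → ℂ}
    (hF : DifferentiableOn ℂ F (Metric.ball 0 ρ)) :
    bdry R F ∈ HPlus ∧ ∀ w, ‖w‖ < R → evalAt R w (bdry R F) = F w := by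
  set a : ℕ → ℂ := fun n => (n.factorial : ℂ)⁻¹ * iteratedDeriv n F 0
  have hT : ∀ z, ‖z‖ < ρ → HasSum (fun n => a n * z ^ n) (F z) := by
    intro z hz
    have := Complex.hasSum_taylorSeries_on_ball hF (z := z) (by simpa using hz)
    convert! this using 2 with n
    simp only [a, sub_zero, smul_eq_mul]
    ring
  have hR' : ‖(R : ℂ)‖ = R := by rw [Complex.norm_real, Real.norm_of_nonneg hR.le]
  have hS : HasSum (fun n : ℕ => (a n * (R : ℂ) ^ n) • (fourierLp 2 (n : ℤ) : H)) (bdry R F) := by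
    refine hasSum_bdry (e := fun n : ℕ => (n : ℤ))
      (continuous_comp_of_differentiableOn hR hρ hF) ?_ ?_
    · exact (hT R (by rwa [hR'])).summable.norm
    · intro θ
      have := hT (circlePt R θ) (by rwa [norm_circlePt hR])
      simpa only [circlePt_pow, mul_assoc] using this
  refine ⟨mem_of_hasSum (isClosed_spectralSubspace _) hS fun n => ?_, fun w hw => ?_⟩
  · exact Submodule.smul_mem _ _ (fourierLp_mem_spectralSubspace (by simp))
  · have h1 := (evalAt R w).hasSum hS
    refine h1.unique ?_
    convert! hT w (hw.trans hρ) using 2 with n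
    have : (R : ℂ) ≠ 0 := by exact_mod_cast hR.ne'
    simp only [map_smul, evalAt_fourierLp hw, smul_eq_mul]
    simp only [Nat.cast_nonneg, if_true, Int.toNat_natCast, div_pow]
    field_simp

theorem fourierLp_eq_bdry {R : ℝ} (hR : 0 < R) (n : ℕ) :
    (fourierLp 2 (n : ℤ) : H) = bdry R fun z => (z / R) ^ n := by
  have hR0 : (R : ℂ) ≠ 0 := by exact_mod_cast hR.ne'
  have hc : Continuous fun θ : UnitAddCircle => (circlePt R θ / R) ^ n :=
    ((continuous_circlePt R).div_const _).pow n
  refine eq_bdry (F := fun z => (z / R) ^ n) hc ?_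
  filter_upwards [coeFn_fourierLp 2 (n : ℤ)] with θ h
  rw [h, div_pow, circlePt_pow]
  field_simp

/-! ### Multiplication operators -/

/-- Multiplication by the function `h` restricted to the circle `|z| = R`, as an operator on `H`.
It is `0` if the restriction is not continuous. -/
def mulBy (R : ℝ) (h : ℂ → ℂ) : H →L[ℂ] H := by
  classical
  exact if hc : Continuous fun θ : UnitAddCircle => h (circlePt R θ) then
    (ContinuousLinearMap.mul ℂ ℂ).holderL AddCircle.haarAddCircle ⊤ 2 2
      (ContinuousMap.toLp (E := ℂ) ⊤ AddCircle.haarAddCircle ℂ ⟨_, hc⟩) else 0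

theorem coeFn_mulBy {R : ℝ} {h : ℂ → ℂ} (hc : Continuous fun θ : UnitAddCircle => h (circlePt R θ))
    (f : H) : (mulBy R h f : UnitAddCircle → ℂ) =ᵐ[AddCircle.haarAddCircle]
      fun θ => h (circlePt R θ) * f θ := by
  simp only [mulBy, hc, dif_pos, ContinuousLinearMap.holderL_apply_apply]
  filter_upwards [(ContinuousLinearMap.mul ℂ ℂ).coeFn_holder (r := 2)
      (ContinuousMap.toLp (E := ℂ) ⊤ AddCircle.haarAddCircle ℂ
        (⟨_, hc⟩ : C(UnitAddCircle, ℂ))) f,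
    ContinuousMap.coeFn_toLp (E := ℂ) (p := ⊤) (𝕜 := ℂ) AddCircle.haarAddCircle
      (⟨_, hc⟩ : C(UnitAddCircle, ℂ))] with θ h1 h2
  rw [h1, h2]
  rfl

theorem mulBy_bdry {R : ℝ} {h F : ℂ → ℂ}
    (hc : Continuous fun θ : UnitAddCircle => h (circlePt R θ))
    (hF : Continuous fun θ : UnitAddCircle => F (circlePt R θ)) :
    mulBy R h (bdry R F) = bdry R fun z => h z * F z := by
  refine eq_bdry (F := fun z => h z * F z) (hc.mul hF) ?_
  filter_upwards [coeFn_mulBy hc (bdry R F), coeFn_bdry hF] with θ h1 h2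
  rw [h1, h2]

/-- Multiplication by a function that is holomorphic on a neighbourhood of the disc preserves `H₊`
and is compatible with evaluation inside the disc. -/
theorem mulBy_mem_HPlus_and_evalAt {R ρ : ℝ} (hR : 0 < R) (hρ : R < ρ) {h : ℂ → ℂ}
    (hh : DifferentiableOn ℂ h (Metric.ball 0 ρ)) {p : H} (hp : p ∈ HPlus) :
    mulBy R h p ∈ HPlus ∧ ∀ w, ‖w‖ < R → evalAt R w (mulBy R h p) = h w * evalAt R w p := by
  have hmono : ∀ n : ℕ, mulBy R h (fourierLp 2 (n : ℤ)) ∈ HPlus ∧ ∀ w, ‖w‖ < R →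
      evalAt R w (mulBy R h (fourierLp 2 (n : ℤ))) =
        h w * evalAt R w (fourierLp 2 (n : ℤ) : H) := by
    intro n
    have hd : DifferentiableOn ℂ (fun z : ℂ => (z / R) ^ n) (Metric.ball 0 ρ) := by fun_prop
    rw [fourierLp_eq_bdry hR, mulBy_bdry (continuous_comp_of_differentiableOn hR hρ hh)
      (continuous_comp_of_differentiableOn hR hρ hd)]
    have h1 := bdry_mem_HPlus_and_evalAt hR hρ (hh.mul hd)
    have h2 := bdry_mem_HPlus_and_evalAt hR hρ hd
    exact ⟨h1.1, fun w hw => by rw [h2.2 w hw]; exact h1.2 w hw⟩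
  refine ⟨?_, fun w hw => ?_⟩
  · refine mem_of_hasSum (isClosed_spectralSubspace _) ((mulBy R h).hasSum (hasSum_HPlus hp))
      fun n => ?_
    simp only [map_smul]
    exact Submodule.smul_mem _ _ (hmono n).1
  · have h1 := ((evalAt R w).comp (mulBy R h)).hasSum (hasSum_HPlus hp)
    have h2 := (h w • evalAt R w).hasSum (hasSum_HPlus hp)
    refine h1.unique ?_
    convert! h2 using 2 with n
    simp only [map_smul, ContinuousLinearMap.comp_apply,
      smul_apply, (hmono n).2 w hw, smul_eq_mul]

/-! ### Simple poles inside the disc -/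

/-- The function `1 / (z - a)` on the circle `|z| = R`. -/
def pole (R : ℝ) (a : ℂ) : H := bdry R fun z => 1 / (z - a)

theorem continuous_pole {R : ℝ} (hR : 0 < R) {a : ℂ} (ha : ‖a‖ < R) :
    Continuous fun θ : UnitAddCircle => 1 / (circlePt R θ - a) := by
  refine continuous_const.div ((continuous_circlePt R).sub continuous_const) fun θ h => ?_
  rw [sub_eq_zero] at h
  rw [← h, norm_circlePt hR] at ha
  exact lt_irrefl _ ha

theorem hasSum_pole {R : ℝ} (hR : 0 < R) {a : ℂ} (ha : ‖a‖ < R) :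
    HasSum (fun n : ℕ => (a ^ n / (R : ℂ) ^ (n + 1)) • (fourierLp 2 (-((n : ℤ) + 1)) : H))
      (pole R a) := by
  have hR0 : (R : ℂ) ≠ 0 := by exact_mod_cast hR.ne'
  refine hasSum_bdry (F := fun z => 1 / (z - a)) (e := fun n : ℕ => -((n : ℤ) + 1))
    (continuous_pole hR ha) ?_ ?_
  · have : (fun n : ℕ => ‖a ^ n / (R : ℂ) ^ (n + 1)‖) = fun n : ℕ => ‖a / R‖ ^ n * ‖(R : ℂ)‖⁻¹ := by
      funext n
      rw [← norm_pow, ← norm_inv, ← norm_mul]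
      congr 1
      rw [div_pow, pow_succ]
      field_simp
    rw [this]
    exact (summable_geometric_of_lt_one (norm_nonneg _) (norm_div_ofReal_lt_one ha)).mul_right _
  · intro θ
    have hz : ‖circlePt R θ‖ = R := norm_circlePt hR θ
    have hz0 : circlePt R θ ≠ 0 := by
      rw [← norm_pos_iff, hz]; exact hR
    have hlt : ‖a / circlePt R θ‖ < 1 := by
      rw [norm_div, hz]; exact (div_lt_one hR).2 ha
    have hne : circlePt R θ - a ≠ 0 := by
      intro h
      rw [sub_eq_zero] at h
      rw [← h, hz] at ha
      exact lt_irrefl _ ha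
    have h1 := (hasSum_geometric_of_norm_lt_one hlt).mul_right (circlePt R θ)⁻¹
    convert! h1 using 1
    · funext n
      have hinv : fourier (-((n : ℤ) + 1)) θ * fourier ((n + 1 : ℕ) : ℤ) θ = (1 : ℂ) := by
        rw [← fourier_add, Nat.cast_succ, neg_add_cancel, fourier_zero]
      have h0 : (fourier ((n + 1 : ℕ) : ℤ) θ : ℂ) ≠ 0 := right_ne_zero_of_mul_eq_one hinv
      rw [eq_div_of_mul_eq h0 hinv]
      have h2 := circlePt_pow R (n + 1) θ
      rw [div_mul_div_comm, mul_one, ← h2, div_pow, pow_succ]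
      field_simp
    · rw [one_sub_div hz0]
      field_simp

theorem pole_mem_HMinus {R : ℝ} (hR : 0 < R) {a : ℂ} (ha : ‖a‖ < R) : pole R a ∈ HMinus :=
  mem_of_hasSum (isClosed_spectralSubspace _) (hasSum_pole hR ha) fun n =>
    Submodule.smul_mem _ _ (fourierLp_mem_spectralSubspace (by
      change -((n : ℤ) + 1) < 0
      omega))

theorem differentiableOn_dslope_ball {ρ : ℝ} {h : ℂ → ℂ}
    (hh : DifferentiableOn ℂ h (Metric.ball 0 ρ)) {a : ℂ} (ha : ‖a‖ < ρ) :
    DifferentiableOn ℂ (dslope h a) (Metric.ball 0 ρ) :=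
  (Complex.differentiableOn_dslope (Metric.isOpen_ball.mem_nhds (by simpa using ha))).2 hh

/-- Division with remainder: `h(z) / (z - a)` is `h(a) / (z - a)` plus a function that is
holomorphic on the disc. -/
theorem mulBy_pole {R ρ : ℝ} (hR : 0 < R) (hρ : R < ρ) {h : ℂ → ℂ}
    (hh : DifferentiableOn ℂ h (Metric.ball 0 ρ)) {a : ℂ} (ha : ‖a‖ < R) :
    mulBy R h (pole R a) = h a • pole R a + bdry R (dslope h a) := by
  have hd := continuous_comp_of_differentiableOn hR hρ
    (differentiableOn_dslope_ball hh (ha.trans hρ))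
  have hc := continuous_comp_of_differentiableOn hR hρ hh
  refine Lp.ext ?_
  filter_upwards [coeFn_mulBy hc (pole R a),
    coeFn_bdry (F := fun z => 1 / (z - a)) (continuous_pole hR ha),
    Lp.coeFn_add (h a • pole R a) (bdry R (dslope h a)), Lp.coeFn_smul (h a) (pole R a),
    coeFn_bdry hd] with θ h1 h2 h3 h4 h5
  have h2' : pole R a θ = 1 / (circlePt R θ - a) := h2
  have hne : circlePt R θ ≠ a := by
    intro h
    rw [← h, norm_circlePt hR] at ha
    exact lt_irrefl _ ha
  have hne' : circlePt R θ - a ≠ 0 := sub_ne_zero.2 hne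
  rw [h1, h3, Pi.add_apply, h4, Pi.smul_apply, h5, h2', dslope_of_ne _ hne, slope_def_field,
    smul_eq_mul]
  field_simp
  ring

variable {N : ℕ}

/-! ### The subspaces with prescribed simple poles -/

/-- The hypotheses on the poles `λᵢ`: they are distinct, no `λᵢ - 1` is one of the `λⱼ`, and all
`λᵢ` and `λᵢ - 1` lie inside the circle. In `sep`, the case `i = j` is no restriction. -/
structure IsPolar (R : ℝ) (l : Fin N → ℂ) : Prop where
  pos : 0 < R
  inj : Function.Injective l
  sep : ∀ i j, l i - l j ≠ 1
  lt : ∀ i, ‖l i‖ < R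
  lt' : ∀ i, ‖l i - 1‖ < R

/-- The Lagrange polynomial that is `1` at `λᵢ` and `0` at the other `λⱼ`, times `z - λᵢ`. -/
def residueWeight (l : Fin N → ℂ) (i : Fin N) (z : ℂ) : ℂ :=
  (Lagrange.basis Finset.univ l i).eval z * (z - l i)

/-- The residue at `λᵢ`, as a bounded functional on `H`. On `H₊` plus the span of the functions
`1 / (z - λⱼ)` it is the coefficient of `1 / (z - λᵢ)`: the product of such a function with
`residueWeight l i` is holomorphic on the disc, and its value at `λᵢ` is this coefficient. -/
def resAt (R : ℝ) (l : Fin N → ℂ) (i : Fin N) : H →L[ℂ] ℂ :=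
  evalAt R (l i) ∘L mulBy R (residueWeight l i)

theorem differentiable_residueWeight (l : Fin N → ℂ) (i : Fin N) :
    Differentiable ℂ (residueWeight l i) :=
  (Polynomial.differentiable _).mul (differentiable_id.sub_const _)

theorem residueWeight_apply {l : Fin N → ℂ} (i j : Fin N) :
    residueWeight l i (l j) = 0 := by
  unfold residueWeight
  by_cases h : i = j
  · rw [h, sub_self, mul_zero]
  · rw [Lagrange.eval_basis_of_ne h (Finset.mem_univ j), zero_mul]

theorem evalAt_pole {R : ℝ} (hR : 0 < R) {a w : ℂ} (ha : ‖a‖ < R) (hw : ‖w‖ < R) :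
    evalAt R w (pole R a) = 0 := by
  refine ((evalAt R w).hasSum (hasSum_pole hR ha)).unique ?_
  convert! hasSum_zero using 2 with n
  rw [map_smul, evalAt_fourierLp hw, if_neg (by omega), smul_zero]

theorem resAt_HPlus {R : ℝ} {l : Fin N → ℂ} (hl : IsPolar R l) (i : Fin N) {p : H}
    (hp : p ∈ HPlus) : resAt R l i p = 0 := by
  rw [resAt, ContinuousLinearMap.comp_apply, (mulBy_mem_HPlus_and_evalAt hl.pos (lt_add_one R)
    (differentiable_residueWeight l i).differentiableOn hp).2 _ (hl.lt i), residueWeight_apply,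
    zero_mul]

theorem resAt_pole {R : ℝ} {l : Fin N → ℂ} (hl : IsPolar R l) (i j : Fin N) :
    resAt R l i (pole R (l j)) = if i = j then 1 else 0 := by
  have hd := (differentiable_residueWeight l i).differentiableOn (s := Metric.ball 0 (R + 1))
  rw [resAt, ContinuousLinearMap.comp_apply, mulBy_pole hl.pos (lt_add_one R) hd (hl.lt j),
    residueWeight_apply, zero_smul, zero_add, (bdry_mem_HPlus_and_evalAt hl.pos (lt_add_one R)
      (differentiableOn_dslope_ball hd ((hl.lt j).trans (lt_add_one R)))).2 _ (hl.lt i)]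
  split_ifs with h
  · subst h
    rw [dslope_same]
    have h1 : HasDerivAt (residueWeight l i) _ (l i) :=
      ((Lagrange.basis Finset.univ l i).hasDerivAt (l i)).mul
        ((hasDerivAt_id (l i)).sub_const (l i))
    rw [h1.deriv]
    simp [Lagrange.eval_basis_self hl.inj.injOn (Finset.mem_univ i)]
  · rw [dslope_of_ne _ (fun h' => h (hl.inj h')), slope_def_field, residueWeight_apply,
      residueWeight_apply, sub_self, zero_div]

/-- The matrix with entries `1 / (1 + λⱼ - λᵢ)`. -/
def cauchyMat (l : Fin N → ℂ) : Matrix (Fin N) (Fin N) ℂ :=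
  Matrix.of fun i j => 1 / (1 + l j - l i)

/-- The matrix of the linear system for the residues of an element of `polarSpace R l ν`. -/
def bakerMat (l ν : Fin N → ℂ) : Matrix (Fin N) (Fin N) ℂ :=
  1 - Matrix.diagonal ν * cauchyMat l

theorem bakerMat_mulVec (l ν α : Fin N → ℂ) (i : Fin N) :
    (bakerMat l ν).mulVec α i = α i - ν i * ∑ j, α j / (1 + l j - l i) := by
  simp only [bakerMat, Matrix.sub_mulVec, Matrix.one_mulVec, Pi.sub_apply, ← Matrix.mulVec_mulVec,
    Matrix.mulVec_diagonal]
  simp only [Matrix.mulVec, dotProduct, cauchyMat, Matrix.of_apply, one_div_mul_eq_div]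

/-- The functions `f = p + ∑ αⱼ / (z - λⱼ)` with `p ∈ H₊` and `αᵢ + νᵢ f(λᵢ - 1) = 0` for all `i`.
The last condition is the linear system `bakerMat l ν α = -ν p(λ - 1)`. -/
def polarSpace (R : ℝ) (l ν : Fin N → ℂ) : Submodule ℂ H where
  carrier := {f | f - ∑ j, resAt R l j f • pole R (l j) ∈ HPlus ∧
    ∀ i, (bakerMat l ν).mulVec (fun j => resAt R l j f) i + ν i * evalAt R (l i - 1) f = 0}
  zero_mem' := by
    simp only [bakerMat_mulVec]
    simp
  add_mem' := by
    rintro f g ⟨hf, hf'⟩ ⟨hg, hg'⟩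
    refine ⟨?_, fun i => ?_⟩
    · convert! HPlus.add_mem hf hg using 1
      simp only [map_add, add_smul, Finset.sum_add_distrib]
      abel
    · have := congr_arg₂ (· + ·) (hf' i) (hg' i)
      simp only [bakerMat_mulVec, map_add, add_div, Finset.sum_add_distrib] at this ⊢
      linear_combination this
  smul_mem' := by
    rintro c f ⟨hf, hf'⟩
    refine ⟨?_, fun i => ?_⟩
    · convert! HPlus.smul_mem c hf using 1
      simp only [map_smul, smul_sub, Finset.smul_sum, smul_smul, smul_eq_mul]
    · have := congr_arg (c * ·) (hf' i)
      simp only [bakerMat_mulVec, map_smul, smul_eq_mul, mul_div_assoc,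
        ← Finset.mul_sum] at this ⊢
      linear_combination this

theorem mem_polarSpace_iff {R : ℝ} {l ν : Fin N → ℂ} {f : H} :
    f ∈ polarSpace R l ν ↔ f - ∑ j, resAt R l j f • pole R (l j) ∈ HPlus ∧
      ∀ i, (bakerMat l ν).mulVec (fun j => resAt R l j f) i + ν i * evalAt R (l i - 1) f = 0 :=
  Iff.rfl

theorem resAt_add_sum {R : ℝ} {l : Fin N → ℂ} (hl : IsPolar R l) {p : H} (hp : p ∈ HPlus)
    (α : Fin N → ℂ) (i : Fin N) : resAt R l i (p + ∑ j, α j • pole R (l j)) = α i := by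
  simp [resAt_HPlus hl i hp, resAt_pole hl]

theorem evalAt_add_sum {R : ℝ} {l : Fin N → ℂ} (hl : IsPolar R l) (p : H)
    (α : Fin N → ℂ) {w : ℂ} (hw : ‖w‖ < R) :
    evalAt R w (p + ∑ j, α j • pole R (l j)) = evalAt R w p := by
  simp [evalAt_pole hl.pos (hl.lt _) hw]

theorem add_sum_mem_polarSpace_iff {R : ℝ} {l ν : Fin N → ℂ} (hl : IsPolar R l) {p : H}
    (hp : p ∈ HPlus) (α : Fin N → ℂ) :
    p + ∑ j, α j • pole R (l j) ∈ polarSpace R l ν ↔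
      ∀ i, (bakerMat l ν).mulVec α i + ν i * evalAt R (l i - 1) p = 0 := by
  simp only [mem_polarSpace_iff, resAt_add_sum hl hp, evalAt_add_sum hl p α (hl.lt' _),
    add_sub_cancel_right, hp, true_and]

theorem exists_of_mem_polarSpace {R : ℝ} {l ν : Fin N → ℂ} (hl : IsPolar R l) {f : H}
    (hf : f ∈ polarSpace R l ν) : ∃ p ∈ HPlus, ∃ α : Fin N → ℂ,
      f = p + ∑ j, α j • pole R (l j) ∧
      ∀ i, (bakerMat l ν).mulVec α i + ν i * evalAt R (l i - 1) p = 0 := by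
  have hfe : f = (f - ∑ j, resAt R l j f • pole R (l j)) + ∑ j, resAt R l j f • pole R (l j) :=
    (sub_add_cancel _ _).symm
  refine ⟨_, hf.1, _, hfe, (add_sum_mem_polarSpace_iff hl hf.1 _).1 ?_⟩
  rw [← hfe]
  exact hf

theorem isClosed_polarSpace (R : ℝ) (l ν : Fin N → ℂ) :
    IsClosed (polarSpace R l ν : Set H) := by
  have h1 : Continuous fun f : H => f - ∑ j, resAt R l j f • pole R (l j) := by fun_prop
  have h2 : ∀ i, Continuous fun f : H =>
      (bakerMat l ν).mulVec (fun j => resAt R l j f) i + ν i * evalAt R (l i - 1) f := by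
    intro i
    simp only [bakerMat_mulVec]
    fun_prop
  refine IsClosed.inter ((isClosed_spectralSubspace _).preimage h1) ?_
  have h3 : {f : H | ∀ i, (bakerMat l ν).mulVec (fun j => resAt R l j f) i +
      ν i * evalAt R (l i - 1) f = 0} = ⋂ i, {f : H | (bakerMat l ν).mulVec
        (fun j => resAt R l j f) i + ν i * evalAt R (l i - 1) f = 0} := by
    ext f
    simp only [Set.mem_iInter, Set.mem_ofPred_eq]
  have h4 : IsClosed {f : H | ∀ i, (bakerMat l ν).mulVec (fun j => resAt R l j f) i +
      ν i * evalAt R (l i - 1) f = 0} := by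
    rw [h3]
    exact isClosed_iInter fun i => isClosed_eq (h2 i) continuous_const
  exact h4

/-! ### The flow on the subspaces with prescribed poles -/

theorem mulBy_mem_polarSpace {R ρ : ℝ} {l ν : Fin N → ℂ} (hl : IsPolar R l) (hρ : R < ρ)
    {h : ℂ → ℂ} (hh : DifferentiableOn ℂ h (Metric.ball 0 ρ)) (h0 : ∀ i, h (l i - 1) ≠ 0) {f : H}
    (hf : f ∈ polarSpace R l ν) :
    mulBy R h f ∈ polarSpace R l fun i => ν i * (h (l i) / h (l i - 1)) := by
  obtain ⟨p, hp, α, rfl, hα⟩ := exists_of_mem_polarSpace hl hf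
  have hq : ∀ j, bdry R (dslope h (l j)) ∈ HPlus ∧ ∀ w, ‖w‖ < R →
      evalAt R w (bdry R (dslope h (l j))) = dslope h (l j) w := fun j =>
    bdry_mem_HPlus_and_evalAt hl.pos hρ
      (differentiableOn_dslope_ball hh ((hl.lt j).trans hρ))
  have hhp := mulBy_mem_HPlus_and_evalAt hl.pos hρ hh hp
  have key : mulBy R h (p + ∑ j, α j • pole R (l j)) =
      (mulBy R h p + ∑ j, α j • bdry R (dslope h (l j))) +
        ∑ j, (α j * h (l j)) • pole R (l j) := by
    simp only [map_add, map_sum, map_smul, mulBy_pole hl.pos hρ hh (hl.lt _), smul_add, smul_smul,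
      Finset.sum_add_distrib]
    abel
  rw [key, add_sum_mem_polarSpace_iff hl (HPlus.add_mem hhp.1
    (Submodule.sum_mem _ fun j _ => HPlus.smul_mem _ (hq j).1))]
  intro i
  have h1 := hα i
  have hne : ∀ j, 1 + l j - l i ≠ 0 := fun j h =>
    hl.sep i j (by linear_combination -h)
  have hsum : ∑ j, α j * dslope h (l j) (l i - 1) =
      ∑ j, (α j * h (l j)) / (1 + l j - l i) - h (l i - 1) * ∑ j, α j / (1 + l j - l i) := by
    rw [Finset.mul_sum, ← Finset.sum_sub_distrib]
    refine Finset.sum_congr rfl fun j _ => ?_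
    have hne1 : l i - 1 ≠ l j := fun h => hl.sep i j (by linear_combination h)
    have hne2 : l i - 1 - l j ≠ 0 := sub_ne_zero.2 hne1
    rw [dslope_of_ne _ hne1, slope_def_field, show 1 + l j - l i = -(l i - 1 - l j) by ring]
    field_simp
    ring
  simp only [bakerMat_mulVec, map_add, map_sum, map_smul, smul_eq_mul, hhp.2 _ (hl.lt' i),
    (hq _).2 _ (hl.lt' i), hsum] at h1 ⊢
  field_simp [h0 i]
  linear_combination h (l i) * h (l i - 1) * h1

theorem differentiableOn_tsum_pow {ρ : ℝ} {t : ℕ+ → ℂ}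
    (ht : Summable fun k : ℕ+ => ‖t k‖ * ρ ^ (k : ℕ)) :
    DifferentiableOn ℂ (fun z => ∑' k : ℕ+, t k * z ^ (k : ℕ)) (Metric.ball 0 ρ) := by
  refine Complex.differentiableOn_tsum_of_summable_norm ht (fun k => by fun_prop)
    Metric.isOpen_ball ?_
  intro k w hw
  rw [mem_ball_zero_iff] at hw
  rw [norm_mul, norm_pow]
  gcongr

theorem expFlow_ne_zero (t : ℕ+ → ℂ) (z : ℂ) : expFlow t z ≠ 0 := Complex.exp_ne_zero _

/-- The factor by which the flow multiplies the parameter `νᵢ` of `polarSpace`. -/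
def flowFactor (l : Fin N → ℂ) (t : ℕ+ → ℂ) (i : Fin N) : ℂ :=
  expFlow t (l i - 1) / expFlow t (l i)

theorem flow_polarSpace {R : ℝ} {l : Fin N → ℂ} (hl : IsPolar R l) (ν : Fin N → ℂ) {t : ℕ+ → ℂ}
    (ht : t ∈ Times R) :
    flow R t (polarSpace R l ν) = polarSpace R l fun i => ν i * flowFactor l t i := by
  obtain ⟨ρ, hρ, hs⟩ := ht
  have hd : DifferentiableOn ℂ (expFlow t) (Metric.ball 0 ρ) := (differentiableOn_tsum_pow hs).cexp
  have hd' : DifferentiableOn ℂ (fun z => (expFlow t z)⁻¹) (Metric.ball 0 ρ) :=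
    hd.inv fun z _ => expFlow_ne_zero t z
  have hc := continuous_comp_of_differentiableOn hl.pos hρ hd
  have hc' := continuous_comp_of_differentiableOn hl.pos hρ hd'
  ext g
  constructor
  · rintro ⟨f, hf, hg⟩
    have hg' : g = mulBy R (fun z => (expFlow t z)⁻¹) f := by
      refine Lp.ext ?_
      filter_upwards [hg, coeFn_mulBy (h := fun z => (expFlow t z)⁻¹) hc' f] with θ h1 h2
      rw [h1, h2]
    rw [hg']
    have h1 := mulBy_mem_polarSpace hl hρ hd'
      (fun i => inv_ne_zero (expFlow_ne_zero t (l i - 1))) hf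
    simp only [inv_div_inv] at h1
    exact h1
  · intro hg
    refine ⟨mulBy R (expFlow t) g, ?_, ?_⟩
    · have h1 := mulBy_mem_polarSpace hl hρ hd (fun i => expFlow_ne_zero t (l i - 1)) hg
      have h2 : (fun i => ν i * flowFactor l t i *
          (expFlow t (l i) / expFlow t (l i - 1))) = ν := by
        funext i
        rw [flowFactor, mul_assoc, div_mul_div_cancel₀ (expFlow_ne_zero t _),
          div_self (expFlow_ne_zero t _), mul_one]
      rwa [h2] at h1
    · filter_upwards [coeFn_mulBy hc g] with θ h
      rw [h, inv_mul_cancel_left₀ (expFlow_ne_zero t _)]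

/-! ### The projections of the subspaces with prescribed poles -/

theorem HMinus_le_orthogonal : HMinus ≤ HPlusᗮ := by
  intro s hs
  rw [Submodule.mem_orthogonal']
  intro p hp
  have h := (innerSL ℂ s).hasSum (hasSum_HPlus hp)
  rw [innerSL_apply_apply] at h
  refine h.unique ?_
  convert! hasSum_zero using 2 with n
  have h0 : fourierCoeff (s : UnitAddCircle → ℂ) n = 0 := hs n (by simp)
  rw [fourierCoeff_eq_inner] at h0
  rw [map_smul, innerSL_apply_apply, ← inner_conj_symm, h0, map_zero, smul_zero]

theorem sum_pole_mem_HMinus {R : ℝ} {l : Fin N → ℂ} (hl : IsPolar R l) (α : Fin N → ℂ) :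
    ∑ j, α j • pole R (l j) ∈ HMinus :=
  Submodule.sum_mem _ fun j _ => HMinus.smul_mem _ (pole_mem_HMinus hl.pos (hl.lt j))

theorem proj_add_sum {R : ℝ} {l : Fin N → ℂ} (hl : IsPolar R l) {p : H} (hp : p ∈ HPlus)
    (α : Fin N → ℂ) :
    HPlus.orthogonalProjectionOnto (p + ∑ j, α j • pole R (l j)) = ⟨p, hp⟩ := by
  rw [map_add, Submodule.orthogonalProjectionOnto_apply_of_mem_orthogonal
    (HMinus_le_orthogonal (sum_pole_mem_HMinus hl α)), add_zero]
  exact Submodule.orthogonalProjectionOnto_mem_subspace_eq_self (⟨p, hp⟩ : HPlus)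

theorem coe_projPlus_polarSpace {R : ℝ} {l ν : Fin N → ℂ} (hl : IsPolar R l)
    (f : polarSpace R l ν) :
    (projPlus (polarSpace R l ν) f : H) = f - ∑ j, resAt R l j f • pole R (l j) := by
  have h := proj_add_sum hl f.2.1 fun j => resAt R l j f
  rw [sub_add_cancel] at h
  exact congr_arg Subtype.val h

theorem bakerMat_mulVec_resAt {R : ℝ} {l ν : Fin N → ℂ} (hl : IsPolar R l)
    (f : polarSpace R l ν) (i : Fin N) :
    (bakerMat l ν).mulVec (fun j => resAt R l j f) i +
      ν i * evalAt R (l i - 1) (projPlus (polarSpace R l ν) f : H) = 0 := by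
  have h := f.2.2 i
  have h1 := evalAt_add_sum hl ((f : H) - ∑ j, resAt R l j f • pole R (l j))
    (fun j => resAt R l j f) (hl.lt' i)
  rw [sub_add_cancel] at h1
  rw [coe_projPlus_polarSpace hl, ← h1]
  exact h

/-- The element `p + ∑ αⱼ / (z - λⱼ)` of `polarSpace R l ν`. -/
def polarMk {R : ℝ} {l : Fin N → ℂ} (hl : IsPolar R l) (ν : Fin N → ℂ) (p : HPlus)
    (α : Fin N → ℂ)
    (h : ∀ i, (bakerMat l ν).mulVec α i + ν i * evalAt R (l i - 1) (p : H) = 0) :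
    polarSpace R l ν :=
  ⟨p + ∑ j, α j • pole R (l j), (add_sum_mem_polarSpace_iff hl p.2 α).2 h⟩

theorem projPlus_polarMk {R : ℝ} {l : Fin N → ℂ} (hl : IsPolar R l) (ν : Fin N → ℂ) (p : HPlus)
    (α : Fin N → ℂ)
    (h : ∀ i, (bakerMat l ν).mulVec α i + ν i * evalAt R (l i - 1) (p : H) = 0) :
    projPlus (polarSpace R l ν) (polarMk hl ν p α h) = p :=
  proj_add_sum hl p.2 α

theorem resAt_polarMk {R : ℝ} {l : Fin N → ℂ} (hl : IsPolar R l) (ν : Fin N → ℂ) (p : HPlus)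
    (α : Fin N → ℂ)
    (h : ∀ i, (bakerMat l ν).mulVec α i + ν i * evalAt R (l i - 1) (p : H) = 0) (i : Fin N) :
    resAt R l i (polarMk hl ν p α h) = α i :=
  resAt_add_sum hl p.2 α i

theorem eq_zero_of_projPlus_of_resAt {R : ℝ} {l ν : Fin N → ℂ} (hl : IsPolar R l)
    {f : polarSpace R l ν} (h : projPlus (polarSpace R l ν) f = 0) (h' : ∀ i, resAt R l i f = 0) :
    f = 0 := by
  have h1 := coe_projPlus_polarSpace hl f
  simp only [h, h', zero_smul, Finset.sum_const_zero, sub_zero, Submodule.coe_zero] at h1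
  exact Subtype.ext h1.symm

/-- `polarSpace R l ν` is transverse if and only if the linear system for the residues has a
unique solution. -/
theorem transverse_polarSpace_iff {R : ℝ} {l ν : Fin N → ℂ} (hl : IsPolar R l) :
    Transverse (polarSpace R l ν) ↔ (bakerMat l ν).det ≠ 0 := by
  constructor
  · intro h hdet
    obtain ⟨α, hα, h0⟩ := Matrix.exists_mulVec_eq_zero_iff.2 hdet
    have hmk : ∀ i, (bakerMat l ν).mulVec α i + ν i * evalAt R (l i - 1) ((0 : HPlus) : H) = 0 := by
      intro i
      simp [h0]
    refine hα (funext fun i => ?_)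
    have h1 : polarMk hl ν 0 α hmk = 0 := h.1 (by rw [projPlus_polarMk, map_zero])
    rw [← resAt_polarMk hl ν 0 α hmk i, h1]
    simp
  · intro h
    constructor
    · rw [injective_iff_map_eq_zero]
      intro f hf
      refine eq_zero_of_projPlus_of_resAt hl hf fun i => ?_
      have h1 : (bakerMat l ν).mulVec (fun j => resAt R l j f) = 0 := by
        funext i
        have := bakerMat_mulVec_resAt hl f i
        simpa [hf] using this
      exact congr_fun (Matrix.eq_zero_of_mulVec_eq_zero h h1) i
    · intro p
      refine ⟨polarMk hl ν p ((bakerMat l ν)⁻¹.mulVec fun i => -(ν i * evalAt R (l i - 1) (p : H)))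
        fun i => ?_, projPlus_polarMk hl ν p _ _⟩
      rw [Matrix.mulVec_mulVec, Matrix.mul_nonsing_inv _ (isUnit_iff_ne_zero.2 h),
        Matrix.one_mulVec, neg_add_cancel]

/-! ### Membership in the Grassmannian -/

/-- The function on the circle given by the Lagrange polynomial that is `1` at `λᵢ - 1` and `0` at
the other `λⱼ - 1`. -/
def nodeBasis (R : ℝ) (l : Fin N → ℂ) (i : Fin N) : H :=
  bdry R fun z => (Lagrange.basis Finset.univ (fun k => l k - 1) i).eval z

theorem nodeBasis_mem_HPlus {R : ℝ} {l : Fin N → ℂ} (hl : IsPolar R l) (i : Fin N) :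
    nodeBasis R l i ∈ HPlus :=
  (bdry_mem_HPlus_and_evalAt hl.pos (lt_add_one R)
    (Polynomial.differentiable _).differentiableOn).1

theorem evalAt_nodeBasis {R : ℝ} {l : Fin N → ℂ} (hl : IsPolar R l) (i j : Fin N) :
    evalAt R (l j - 1) (nodeBasis R l i) = if i = j then 1 else 0 := by
  rw [nodeBasis, (bdry_mem_HPlus_and_evalAt hl.pos (lt_add_one R)
    (Polynomial.differentiable _).differentiableOn).2 _ (hl.lt' j)]
  have hinj : Function.Injective fun k => l k - 1 := fun a b h => hl.inj (sub_left_injective h)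
  split_ifs with h
  · subst h
    exact Lagrange.eval_basis_self hinj.injOn (Finset.mem_univ i)
  · exact Lagrange.eval_basis_of_ne (v := fun k => l k - 1) h (Finset.mem_univ j)

/-- An operator between Banach spaces with closed range, finite dimensional kernel and finite
dimensional cokernel is Fredholm. -/
theorem isFredholm_of_finiteDimensional {E F : Type*} [NormedAddCommGroup E] [NormedSpace ℂ E]
    [CompleteSpace E] [NormedAddCommGroup F] [NormedSpace ℂ F] [CompleteSpace F] (u : E →L[ℂ] F)
    (hr : IsClosed (u.range : Set F)) (hk : FiniteDimensional ℂ u.ker)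
    (hc : FiniteDimensional ℂ (F ⧸ u.range)) : u.IsFredholm where
  isStrictMap := by
    have : CompleteSpace u.range := hr.completeSpace_coe
    have ho : IsOpenMap u.rangeRestrict :=
      u.rangeRestrict.isOpenMap (LinearMap.surjective_rangeRestrict _)
    exact (Topology.IsEmbedding.subtypeVal.isStrictMap_iff (f := u.rangeRestrict)).1
      (ho.isStrictMap u.rangeRestrict.continuous)
  isClosed_range := hr
  finite_ker := hk
  finite_coker := hc
  closedComplemented_ker := Submodule.ClosedComplemented.of_finiteDimensional _

/-- The values `νᵢ p(λᵢ - 1)` of `p ∈ H₊`. -/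
def nodeValues (R : ℝ) (l ν : Fin N → ℂ) : HPlus →L[ℂ] (Fin N → ℂ) :=
  ContinuousLinearMap.pi fun i => ν i • (evalAt R (l i - 1) ∘L HPlus.subtypeL)

theorem nodeValues_apply (R : ℝ) (l ν : Fin N → ℂ) (p : HPlus) (i : Fin N) :
    nodeValues R l ν p i = ν i * evalAt R (l i - 1) (p : H) := rfl

theorem nodeValues_surjective {R : ℝ} {l ν : Fin N → ℂ} (hl : IsPolar R l) (hν : ∀ i, ν i ≠ 0) :
    Function.Surjective (nodeValues R l ν) := by
  intro c
  refine ⟨⟨∑ i, (c i / ν i) • nodeBasis R l i,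
    Submodule.sum_mem _ fun i _ => HPlus.smul_mem _ (nodeBasis_mem_HPlus hl i)⟩, ?_⟩
  funext j
  rw [nodeValues_apply]
  simp only [map_sum, map_smul, evalAt_nodeBasis hl, smul_eq_mul, mul_ite, mul_one, mul_zero,
    Finset.sum_ite_eq', Finset.mem_univ, if_true]
  rw [mul_div_cancel₀ _ (hν j)]

theorem mem_range_projPlus_iff {R : ℝ} {l ν : Fin N → ℂ} (hl : IsPolar R l) (p : HPlus) :
    p ∈ (projPlus (polarSpace R l ν)).range ↔
      nodeValues R l ν p ∈ (bakerMat l ν).mulVecLin.range := by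
  constructor
  · rintro ⟨f, rfl⟩
    refine ⟨-fun j => resAt R l j f, ?_⟩
    rw [Matrix.mulVecLin_apply, Matrix.mulVec_neg]
    funext i
    exact neg_eq_of_add_eq_zero_right (bakerMat_mulVec_resAt hl f i)
  · rintro ⟨α, hα⟩
    refine ⟨polarMk hl ν p (-α) fun i => ?_, projPlus_polarMk hl ν p _ _⟩
    rw [← nodeValues_apply, ← hα, Matrix.mulVecLin_apply, Matrix.mulVec_neg, Pi.neg_apply,
      neg_add_cancel]

/-- The kernel of the projection to `H₊` is the kernel of the matrix `bakerMat l ν`, by taking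
residues. -/
def kerProjPlusEquiv {R : ℝ} {l ν : Fin N → ℂ} (hl : IsPolar R l) :
    (projPlus (polarSpace R l ν)).ker ≃ₗ[ℂ] (bakerMat l ν).mulVecLin.ker :=
  LinearEquiv.ofBijective
    (LinearMap.codRestrict _
      ((LinearMap.pi fun j => (resAt R l j : H →ₗ[ℂ] ℂ)) ∘ₗ (polarSpace R l ν).subtype ∘ₗ
        (projPlus (polarSpace R l ν)).ker.subtype) (by
      intro f
      have hf : projPlus (polarSpace R l ν) f.1 = 0 := f.2
      rw [LinearMap.mem_ker, Matrix.mulVecLin_apply]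
      funext i
      have h := bakerMat_mulVec_resAt hl f.1 i
      rw [hf, Submodule.coe_zero, map_zero, mul_zero, add_zero] at h
      exact h)) (by
    constructor
    · rw [injective_iff_map_eq_zero]
      intro f hf
      refine Subtype.ext (eq_zero_of_projPlus_of_resAt hl f.2 fun i => ?_)
      exact congr_fun (congr_arg Subtype.val hf) i
    · rintro ⟨α, hα⟩
      rw [LinearMap.mem_ker, Matrix.mulVecLin_apply] at hα
      have h : ∀ i, (bakerMat l ν).mulVec α i +
          ν i * evalAt R (l i - 1) ((0 : HPlus) : H) = 0 := fun i => by simp [hα]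
      refine ⟨⟨polarMk hl ν 0 α h, projPlus_polarMk hl ν 0 α h⟩, Subtype.ext (funext fun i => ?_)⟩
      exact resAt_polarMk hl ν 0 α h i)

/-- The cokernel of the projection to `H₊` is the cokernel of the matrix `bakerMat l ν`, by taking
values at the points `λᵢ - 1`. -/
def cokerProjPlusEquiv {R : ℝ} {l ν : Fin N → ℂ} (hl : IsPolar R l) (hν : ∀ i, ν i ≠ 0) :
    (HPlus ⧸ (projPlus (polarSpace R l ν)).range) ≃ₗ[ℂ]
      ((Fin N → ℂ) ⧸ (bakerMat l ν).mulVecLin.range) :=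
  (Submodule.quotEquivOfEq _ _ (by
    ext p
    rw [mem_range_projPlus_iff hl, LinearMap.mem_ker, LinearMap.comp_apply, Submodule.mkQ_apply,
      Submodule.Quotient.mk_eq_zero]
    rfl)).trans
  (LinearMap.quotKerEquivOfSurjective
    ((bakerMat l ν).mulVecLin.range.mkQ ∘ₗ (nodeValues R l ν : HPlus →ₗ[ℂ] (Fin N → ℂ)))
    ((Submodule.mkQ_surjective _).comp (nodeValues_surjective hl hν)))

theorem memGr_polarSpace {R : ℝ} {l ν : Fin N → ℂ} (hl : IsPolar R l) (hν : ∀ i, ν i ≠ 0) :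
    MemGr (polarSpace R l ν) where
  isClosed := isClosed_polarSpace R l ν
  fredholm := by
    have : CompleteSpace (polarSpace R l ν) := (isClosed_polarSpace R l ν).completeSpace_coe
    refine isFredholm_of_finiteDimensional _ ?_ (kerProjPlusEquiv hl).symm.finiteDimensional
      (cokerProjPlusEquiv hl hν).symm.finiteDimensional
    have h : ((projPlus (polarSpace R l ν)).range : Set HPlus) =
        nodeValues R l ν ⁻¹' ((bakerMat l ν).mulVecLin.range : Set (Fin N → ℂ)) := by
      ext p
      exact mem_range_projPlus_iff hl p
    rw [h]
    exact (Submodule.closed_of_finiteDimensional _).preimage (nodeValues R l ν).continuous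
  index_zero := by
    rw [(kerProjPlusEquiv hl).finrank_eq, (cokerProjPlusEquiv hl hν).finrank_eq]
    have h1 := LinearMap.finrank_range_add_finrank_ker (bakerMat l ν).mulVecLin
    have h2 := Submodule.finrank_quotient_add_finrank (bakerMat l ν).mulVecLin.range
    omega
  compact := by
    -- The projection factors through the residues, hence through `ℂᴺ`.
    have h : projMinus (polarSpace R l ν) =
        (∑ j, (ContinuousLinearMap.proj (R := ℂ) (φ := fun _ : Fin N => ℂ) j).smulRight
          (HMinus.orthogonalProjectionOnto (pole R (l j)))) ∘L
        ContinuousLinearMap.pi fun j => resAt R l j ∘L (polarSpace R l ν).subtypeL := by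
      ext1 f
      have hp : HMinus.orthogonalProjectionOnto
          ((f : H) - ∑ j, resAt R l j f • pole R (l j)) = 0 := by
        refine Submodule.orthogonalProjectionOnto_apply_of_mem_orthogonal ?_
        exact Submodule.orthogonal_le HMinus_le_orthogonal
          (Submodule.le_orthogonal_orthogonal _ f.2.1)
      rw [map_sub, sub_eq_zero] at hp
      simp only [projMinus, ContinuousLinearMap.comp_apply, Submodule.subtypeL_apply, hp, map_sum,
        map_smul, sum_apply, ContinuousLinearMap.smulRight_apply,
        ContinuousLinearMap.proj_apply, ContinuousLinearMap.pi_apply]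
    rw [h]
    exact (isCompactOperator_of_locallyCompactSpace_rng (∑ j, (ContinuousLinearMap.proj (R := ℂ)
      (φ := fun _ : Fin N => ℂ) j).smulRight (HMinus.orthogonalProjectionOnto
        (pole R (l j))))).comp_clm _

/-! ### Partial fractions -/

theorem regularAt_of_eq_div {f : RatFunc ℂ} {w : ℂ} {p q : Polynomial ℂ} (hq : q.eval w ≠ 0)
    (h : f = algebraMap _ _ p / algebraMap _ _ q) : RegularAt f w := by
  have hq0 : q ≠ 0 := by
    rintro rfl
    simp at hq
  intro h0
  obtain ⟨r, hr⟩ := (RatFunc.denom_dvd hq0).2 ⟨p, h⟩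
  exact hq (by rw [hr, Polynomial.eval_mul, h0, zero_mul])

theorem RegularAt.add {f g : RatFunc ℂ} {w : ℂ} (hf : RegularAt f w) (hg : RegularAt g w) :
    RegularAt (f + g) w := by
  intro h
  obtain ⟨r, hr⟩ := RatFunc.denom_add_dvd f g
  have := congr_arg (Polynomial.eval w) hr
  rw [Polynomial.eval_mul, Polynomial.eval_mul, h, zero_mul] at this
  exact mul_ne_zero hf hg this

theorem RegularAt.mul {f g : RatFunc ℂ} {w : ℂ} (hf : RegularAt f w) (hg : RegularAt g w) :
    RegularAt (f * g) w := by
  intro h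
  obtain ⟨r, hr⟩ := RatFunc.denom_mul_dvd f g
  have := congr_arg (Polynomial.eval w) hr
  rw [Polynomial.eval_mul, Polynomial.eval_mul, h, zero_mul] at this
  exact mul_ne_zero hf hg this

theorem regularAt_algebraMap (p : Polynomial ℂ) (w : ℂ) : RegularAt (algebraMap _ _ p) w :=
  regularAt_of_eq_div (p := p) (q := 1) (by simp) (by simp)

theorem regularAt_C (c w : ℂ) : RegularAt (RatFunc.C c) w := by
  rw [← RatFunc.algebraMap_C]
  exact regularAt_algebraMap _ _

theorem X_sub_C_eq (a : ℂ) : (RatFunc.X - RatFunc.C a : RatFunc ℂ) =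
    algebraMap _ _ (Polynomial.X - Polynomial.C a) := by
  rw [map_sub, RatFunc.algebraMap_X, RatFunc.algebraMap_C]

theorem X_sub_C_ne_zero (a : ℂ) : (RatFunc.X - RatFunc.C a : RatFunc ℂ) ≠ 0 := by
  rw [X_sub_C_eq]
  exact RatFunc.algebraMap_ne_zero (Polynomial.X_sub_C_ne_zero a)

theorem regularAt_X_sub_C (a w : ℂ) : RegularAt (RatFunc.X - RatFunc.C a) w := by
  rw [X_sub_C_eq]
  exact regularAt_algebraMap _ _

theorem RegularAt.sum {ι : Type*} {s : Finset ι} {f : ι → RatFunc ℂ} {w : ℂ}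
    (h : ∀ i ∈ s, RegularAt (f i) w) : RegularAt (∑ i ∈ s, f i) w :=
  Finset.sum_induction f (RegularAt · w) (fun _ _ => RegularAt.add)
    (by simpa using regularAt_C 0 w) h

theorem RegularAt.eval_add {f g : RatFunc ℂ} {w : ℂ} (hf : RegularAt f w) (hg : RegularAt g w) :
    (f + g).eval (RingHom.id ℂ) w = f.eval (RingHom.id ℂ) w + g.eval (RingHom.id ℂ) w :=
  RatFunc.eval_add _ _ hf hg

theorem RegularAt.eval_mul {f g : RatFunc ℂ} {w : ℂ} (hf : RegularAt f w) (hg : RegularAt g w) :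
    (f * g).eval (RingHom.id ℂ) w = f.eval (RingHom.id ℂ) w * g.eval (RingHom.id ℂ) w :=
  RatFunc.eval_mul _ _ hf hg

theorem RegularAt.eval_sum {ι : Type*} {s : Finset ι} {f : ι → RatFunc ℂ} {w : ℂ}
    (h : ∀ i ∈ s, RegularAt (f i) w) :
    (∑ i ∈ s, f i).eval (RingHom.id ℂ) w = ∑ i ∈ s, (f i).eval (RingHom.id ℂ) w := by
  classical
  induction s using Finset.induction_on with
  | empty => simp
  | insert a s ha ih =>
    rw [Finset.sum_insert ha, Finset.sum_insert ha, RegularAt.eval_add (h a (by simp))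
      (RegularAt.sum fun i hi => h i (by simp [hi])), ih fun i hi => h i (by simp [hi])]

theorem eval_algebraMap_ratFunc (p : Polynomial ℂ) (w : ℂ) :
    (algebraMap (Polynomial ℂ) (RatFunc ℂ) p).eval (RingHom.id ℂ) w = p.eval w := by
  rw [RatFunc.eval_algebraMap]
  rfl

theorem eval_X_sub_C (a w : ℂ) :
    (RatFunc.X - RatFunc.C a : RatFunc ℂ).eval (RingHom.id ℂ) w = w - a := by
  rw [X_sub_C_eq, eval_algebraMap_ratFunc]
  simp

/-- The rational function `c / (z - a)`. -/
def simpleFrac (a c : ℂ) : RatFunc ℂ := RatFunc.C c / (RatFunc.X - RatFunc.C a)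

theorem X_sub_C_mul_simpleFrac (a c : ℂ) :
    (RatFunc.X - RatFunc.C a) * simpleFrac a c = RatFunc.C c :=
  mul_div_cancel₀ _ (X_sub_C_ne_zero a)

theorem regularAt_simpleFrac {a w : ℂ} (h : w ≠ a) (c : ℂ) : RegularAt (simpleFrac a c) w := by
  refine regularAt_of_eq_div (p := Polynomial.C c) (q := Polynomial.X - Polynomial.C a)
    (by simpa [sub_eq_zero] using h) ?_
  rw [simpleFrac, X_sub_C_eq, RatFunc.algebraMap_C]

theorem eval_simpleFrac {a w : ℂ} (h : w ≠ a) (c : ℂ) :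
    (simpleFrac a c).eval (RingHom.id ℂ) w = c / (w - a) := by
  have h1 := RegularAt.eval_mul (regularAt_X_sub_C a w) (regularAt_simpleFrac h c)
  rw [X_sub_C_mul_simpleFrac, RatFunc.eval_C, eval_X_sub_C] at h1
  rw [eq_div_iff (sub_ne_zero.2 h), mul_comm]
  exact h1.symm

theorem regularAt_of_simpleResidue_eq_zero {f : RatFunc ℂ} {a : ℂ}
    (h : RegularAt ((RatFunc.X - RatFunc.C a) * f) a) (h0 : simpleResidue f a = 0) :
    RegularAt f a := by
  set u := (RatFunc.X - RatFunc.C a) * f with hu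
  have hn : u.num.eval a = 0 := by
    rw [simpleResidue, RatFunc.eval, div_eq_zero_iff] at h0
    exact h0.resolve_right h
  obtain ⟨q, hq⟩ := Polynomial.dvd_iff_isRoot.2 hn
  refine regularAt_of_eq_div (p := q) (q := u.denom) h ?_
  have h1 := RatFunc.num_div_denom u
  rw [hq, map_mul, ← X_sub_C_eq, mul_div_assoc, hu] at h1
  exact (mul_left_cancel₀ (X_sub_C_ne_zero a) h1).symm

theorem exists_polynomial_of_regularAt {f : RatFunc ℂ} (h : ∀ w, RegularAt f w) :
    ∃ p : Polynomial ℂ, f = algebraMap _ _ p := by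
  have hd : f.denom.degree = 0 := by
    by_contra hd
    obtain ⟨w, hw⟩ := Complex.exists_root (f := f.denom)
      (Polynomial.degree_pos_of_ne_zero_of_nonunit f.denom_ne_zero fun hu => hd (Polynomial.degree_eq_zero_of_isUnit hu))
    exact h w hw
  have h1 : f.denom = 1 := by
    rw [Polynomial.eq_C_of_degree_eq_zero hd]
    have := f.monic_denom
    rw [Polynomial.eq_C_of_degree_eq_zero hd, Polynomial.Monic, Polynomial.leadingCoeff_C] at this
    rw [this, map_one]
  refine ⟨f.num, ?_⟩
  conv_lhs => rw [← RatFunc.num_div_denom f, h1, map_one, div_one]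

/-- The rational function `P + ∑ αⱼ / (z - λⱼ)`. -/
def polarRat (l : Fin N → ℂ) (P : Polynomial ℂ) (α : Fin N → ℂ) : RatFunc ℂ :=
  algebraMap _ _ P + ∑ j, simpleFrac (l j) (α j)

theorem regularAt_polarRat {l : Fin N → ℂ} (P : Polynomial ℂ) (α : Fin N → ℂ) {w : ℂ}
    (hw : ∀ i, w ≠ l i) : RegularAt (polarRat l P α) w :=
  (regularAt_algebraMap P w).add (RegularAt.sum fun j _ => regularAt_simpleFrac (hw j) _)

theorem eval_polarRat {l : Fin N → ℂ} (P : Polynomial ℂ) (α : Fin N → ℂ) {w : ℂ}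
    (hw : ∀ i, w ≠ l i) :
    (polarRat l P α).eval (RingHom.id ℂ) w = P.eval w + ∑ j, α j / (w - l j) := by
  rw [polarRat, RegularAt.eval_add (regularAt_algebraMap P w)
    (RegularAt.sum fun j _ => regularAt_simpleFrac (hw j) _), eval_algebraMap_ratFunc,
    RegularAt.eval_sum fun j _ => regularAt_simpleFrac (hw j) _]
  simp only [eval_simpleFrac (hw _)]

theorem regularAt_and_simpleResidue_polarRat {l : Fin N → ℂ} (hl : Function.Injective l)
    (P : Polynomial ℂ) (α : Fin N → ℂ) (i : Fin N) :
    RegularAt ((RatFunc.X - RatFunc.C (l i)) * polarRat l P α) (l i) ∧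
      simpleResidue (polarRat l P α) (l i) = α i := by
  have hr : RegularAt (algebraMap _ _ P + ∑ j ∈ Finset.univ.erase i, simpleFrac (l j) (α j))
      (l i) :=
    (regularAt_algebraMap P _).add (RegularAt.sum fun j hj =>
      regularAt_simpleFrac (fun h => (Finset.ne_of_mem_erase hj) (hl h).symm) _)
  have he : (RatFunc.X - RatFunc.C (l i)) * polarRat l P α = (RatFunc.X - RatFunc.C (l i)) *
      (algebraMap _ _ P + ∑ j ∈ Finset.univ.erase i, simpleFrac (l j) (α j)) +
        RatFunc.C (α i) := by
    rw [← X_sub_C_mul_simpleFrac (l i) (α i), ← mul_add, polarRat,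
      ← Finset.sum_erase_add _ _ (Finset.mem_univ i), add_assoc]
  have hr' := (regularAt_X_sub_C (l i) (l i)).mul hr
  constructor
  · rw [he]
    exact hr'.add (regularAt_C _ _)
  · rw [simpleResidue, he, RegularAt.eval_add hr' (regularAt_C _ _),
      RegularAt.eval_mul (regularAt_X_sub_C _ _) hr, eval_X_sub_C, RatFunc.eval_C]
    simp

theorem exists_polarRat_of_mem_WAlg {l m : Fin N → ℂ} (hl : Function.Injective l) {f : RatFunc ℂ}
    (hf : f ∈ WAlg l m) :
    ∃ P : Polynomial ℂ, f = polarRat l P fun i => simpleResidue f (l i) := by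
  obtain ⟨h1, h2, -⟩ := hf
  set α := fun i => simpleResidue f (l i)
  have hg : ∀ w, RegularAt (f + polarRat l 0 fun i => -α i) w := by
    intro w
    by_cases hw : ∃ i, w = l i
    · obtain ⟨i, rfl⟩ := hw
      obtain ⟨h3, h4⟩ := regularAt_and_simpleResidue_polarRat hl 0 (fun i => -α i) i
      refine regularAt_of_simpleResidue_eq_zero ?_ ?_
      · rw [mul_add]
        exact (h2 i).add h3
      · rw [simpleResidue, mul_add, RegularAt.eval_add (h2 i) h3]
        rw [simpleResidue] at h4
        rw [h4]
        exact add_neg_cancel (α i)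
    · push Not at hw
      exact (h1 w hw).add (regularAt_polarRat 0 _ hw)
  obtain ⟨P, hP⟩ := exists_polynomial_of_regularAt hg
  refine ⟨P, ?_⟩
  have hneg : ∀ a c : ℂ, simpleFrac a (-c) = -simpleFrac a c := fun a c => by
    rw [simpleFrac, simpleFrac, map_neg]
    ring
  rw [polarRat, ← hP, polarRat, map_zero, zero_add]
  simp only [hneg, Finset.sum_neg_distrib]
  rw [neg_add_cancel_right]

theorem polarRat_mem_WAlg_iff {R : ℝ} {l m : Fin N → ℂ} (hl : IsPolar R l) (P : Polynomial ℂ)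
    (α : Fin N → ℂ) : polarRat l P α ∈ WAlg l m ↔
      ∀ i, (bakerMat l fun i => m i ^ 2).mulVec α i + m i ^ 2 * P.eval (l i - 1) = 0 := by
  have h1 := regularAt_and_simpleResidue_polarRat hl.inj P α
  have hne : ∀ i j, l i - 1 ≠ l j := fun i j h => hl.sep i j (by linear_combination h)
  have h2 : ∀ i, simpleResidue (polarRat l P α) (l i) +
      m i ^ 2 * (polarRat l P α).eval (RingHom.id ℂ) (l i - 1) =
        (bakerMat l fun i => m i ^ 2).mulVec α i + m i ^ 2 * P.eval (l i - 1) := by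
    intro i
    have h3 : ∑ j, α j / (l i - 1 - l j) = -∑ j, α j / (1 + l j - l i) := by
      rw [← Finset.sum_neg_distrib]
      refine Finset.sum_congr rfl fun j _ => ?_
      rw [← div_neg]
      congr 1
      ring
    rw [(h1 i).2, eval_polarRat P α (hne i), bakerMat_mulVec, h3]
    ring
  constructor
  · intro h i
    rw [← h2]
    exact h.2.2 i
  · intro h
    exact ⟨fun w hw => regularAt_polarRat P α hw, fun i => (h1 i).1, fun i => by rw [h2, h i]⟩

/-! ### The closure of the algebraic space -/

/-- The restriction of polynomials to the circle `|z| = R`. -/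
def polyMap (R : ℝ) : Polynomial ℂ →ₗ[ℂ] H where
  toFun P := bdry R fun z => P.eval z
  map_add' P Q := by
    have hc : ∀ P : Polynomial ℂ, Continuous fun θ : UnitAddCircle => P.eval (circlePt R θ) :=
      fun P => P.continuous.comp (continuous_circlePt R)
    refine (eq_bdry (F := fun z => (P + Q).eval z) (hc _) ?_).symm
    filter_upwards [coeFn_bdry (F := fun z => P.eval z) (hc P),
      coeFn_bdry (F := fun z => Q.eval z) (hc Q),
      Lp.coeFn_add (bdry R fun z => P.eval z) (bdry R fun z => Q.eval z)] with θ h1 h2 h3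
    rw [h3, Pi.add_apply, h1, h2, Polynomial.eval_add]
  map_smul' c P := by
    have hc : ∀ P : Polynomial ℂ, Continuous fun θ : UnitAddCircle => P.eval (circlePt R θ) :=
      fun P => P.continuous.comp (continuous_circlePt R)
    refine (eq_bdry (F := fun z => (c • P).eval z) (hc _) ?_).symm
    filter_upwards [coeFn_bdry (F := fun z => P.eval z) (hc P),
      Lp.coeFn_smul c (bdry R fun z => P.eval z)] with θ h1 h2
    rw [RingHom.id_apply, h2, Pi.smul_apply, h1, Polynomial.eval_smul]

theorem polyMap_apply (R : ℝ) (P : Polynomial ℂ) : polyMap R P = bdry R fun z => P.eval z := rfl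

theorem polyMap_mem_HPlus_and_evalAt {R : ℝ} (hR : 0 < R) (P : Polynomial ℂ) :
    polyMap R P ∈ HPlus ∧ ∀ w, ‖w‖ < R → evalAt R w (polyMap R P) = P.eval w :=
  bdry_mem_HPlus_and_evalAt hR (lt_add_one R) (Polynomial.differentiable P).differentiableOn

theorem coeFn_polyMap_add_sum {R : ℝ} {l : Fin N → ℂ} (hl : IsPolar R l) (P : Polynomial ℂ)
    (α : Fin N → ℂ) :
    ((polyMap R P + ∑ j, α j • pole R (l j) : H) : UnitAddCircle → ℂ)
      =ᵐ[AddCircle.haarAddCircle]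
        fun θ => (polarRat l P α).eval (RingHom.id ℂ) (circlePt R θ) := by
  have hpole : ∀ j, (pole R (l j) : UnitAddCircle → ℂ) =ᵐ[AddCircle.haarAddCircle]
      fun θ => 1 / (circlePt R θ - l j) := fun j =>
    coeFn_bdry (F := fun z => 1 / (z - l j)) (continuous_pole hl.pos (hl.lt j))
  have hpoly : (polyMap R P : UnitAddCircle → ℂ) =ᵐ[AddCircle.haarAddCircle]
      fun θ => P.eval (circlePt R θ) :=
    coeFn_bdry (F := fun z => P.eval z) (P.continuous.comp (continuous_circlePt R))
  filter_upwards [hpoly, ae_all_iff.2 hpole,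
    Lp.coeFn_add (polyMap R P) (∑ j, α j • pole R (l j)),
    Lp.coeFn_finsetSum Finset.univ fun j => α j • pole R (l j),
    ae_all_iff.2 fun j => Lp.coeFn_smul (α j) (pole R (l j))] with θ h1 h2 h3 h4 h5
  have hne : ∀ i, circlePt R θ ≠ l i := by
    intro i h
    have := hl.lt i
    rw [← h, norm_circlePt hl.pos] at this
    exact lt_irrefl _ this
  rw [h3, Pi.add_apply, h1, h4, eval_polarRat P α hne, Finset.sum_apply]
  simp only [h5, Pi.smul_apply, h2, smul_eq_mul, mul_one_div]

theorem fourierLp_mem_range_polyMap {R : ℝ} (hR : 0 < R) (n : ℕ) :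
    (fourierLp 2 (n : ℤ) : H) ∈ (polyMap R).range := by
  refine ⟨(Polynomial.C (R : ℂ)⁻¹ * Polynomial.X) ^ n, ?_⟩
  rw [fourierLp_eq_bdry hR, polyMap_apply]
  congr 1
  funext z
  simp [div_eq_inv_mul]

theorem WSpace_eq_polarSpace {R : ℝ} {l : Fin N → ℂ} (hl : IsPolar R l) (m : Fin N → ℂ) :
    WSpace R l m = polarSpace R l fun i => m i ^ 2 := by
  have hmem : ∀ (P : Polynomial ℂ) (α : Fin N → ℂ), polarRat l P α ∈ WAlg l m ↔
      polyMap R P + ∑ j, α j • pole R (l j) ∈ polarSpace R l fun i => m i ^ 2 := by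
    intro P α
    have hP := polyMap_mem_HPlus_and_evalAt hl.pos P
    simp only [polarRat_mem_WAlg_iff hl, add_sum_mem_polarSpace_iff hl hP.1, hP.2 _ (hl.lt' _)]
  apply le_antisymm
  · refine Submodule.topologicalClosure_minimal _ (Submodule.span_le.2 ?_)
      (isClosed_polarSpace R l _)
    rintro g ⟨f, hf, hg⟩
    obtain ⟨P, hP⟩ := exists_polarRat_of_mem_WAlg hl.inj hf
    have h1 := coeFn_polyMap_add_sum hl P fun i => simpleResidue f (l i)
    rw [← hP] at h1
    rw [Lp.ext (hg.trans h1.symm)]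
    exact (hmem P _).1 (hP ▸ hf)
  · intro f hf
    obtain ⟨p, hp, α, rfl, hα⟩ := exists_of_mem_polarSpace hl hf
    -- The partial sums of the Fourier series of `p` are corrected by a polynomial that restores
    -- the values at the points `λᵢ - 1`.
    set Φ : H → H := fun q =>
      q + ∑ i, evalAt R (l i - 1) (p - q) • nodeBasis R l i + ∑ j, α j • pole R (l j) with hΦ
    have hΦc : Continuous Φ := by fun_prop
    have hΦp : Φ p = p + ∑ j, α j • pole R (l j) := by simp [hΦ]
    rw [← hΦp]
    refine (Submodule.isClosed_topologicalClosure _).mem_of_tendsto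
      ((hΦc.tendsto p).comp (hasSum_HPlus hp)) (Filter.Eventually.of_forall fun s => ?_)
    refine Submodule.le_topologicalClosure _ (Submodule.subset_span ?_)
    set q := ∑ n ∈ s, fourierCoeff (p : UnitAddCircle → ℂ) n • (fourierLp 2 (n : ℤ) : H)
    have hq : q + ∑ i, evalAt R (l i - 1) (p - q) • nodeBasis R l i ∈ (polyMap R).range :=
      Submodule.add_mem _
        (Submodule.sum_mem _ fun n _ => Submodule.smul_mem _ _
          (fourierLp_mem_range_polyMap hl.pos n))
        (Submodule.sum_mem _ fun i _ => Submodule.smul_mem _ _ ⟨_, rfl⟩)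
    obtain ⟨P, hP⟩ := hq
    refine ⟨polarRat l P α, ?_, ?_⟩
    · rw [polarRat_mem_WAlg_iff hl]
      intro i
      rw [← (polyMap_mem_HPlus_and_evalAt hl.pos P).2 _ (hl.lt' i), hP]
      convert hα i using 3
      simp [evalAt_nodeBasis hl]
    · have h1 := coeFn_polyMap_add_sum hl P α
      rw [hP] at h1
      exact h1

/-! ### The determinant -/

/-- If `α` solves the linear system of the reduced Baker-Akhiezer function, then the determinant
at the parameters shifted by `z` is the determinant at `ν` times `1 + ∑ αⱼ / (z - λⱼ)`. Indeed, with
`C = cauchyMat l` and `Z = diag λ`, the matrix `(z - Z + 1) C - C (z - Z)` has all entries `1`, so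
that `(z - Z)` times the shifted matrix is `bakerMat l ν` times the rank one perturbation
`(z - Z) + α 1ᵀ` of `z - Z`. -/
theorem det_bakerMat_shift {l ν α : Fin N → ℂ} (hsep : ∀ i j, l i - l j ≠ 1) {z : ℂ}
    (hz : ∀ i, z ≠ l i) (hα : ∀ i, (bakerMat l ν).mulVec α i + ν i = 0) :
    (bakerMat l fun i => ν i * (1 + 1 / (z - l i))).det =
      (bakerMat l ν).det * (1 + ∑ j, α j / (z - l j)) := by
  have hz' : ∀ i, z - l i ≠ 0 := fun i => sub_ne_zero.2 (hz i)
  have hD : (Matrix.diagonal fun i => z - l i).det ≠ 0 := by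
    rw [Matrix.det_diagonal]
    exact Finset.prod_ne_zero_iff.2 fun i _ => hz' i
  have key : Matrix.diagonal (fun i => z - l i) *
      (bakerMat l fun i => ν i * (1 + 1 / (z - l i))) =
      bakerMat l ν * (Matrix.diagonal (fun i => z - l i) *
        (1 + Matrix.replicateCol Unit (fun i => α i / (z - l i)) *
          Matrix.replicateRow Unit fun _ : Fin N => (1 : ℂ))) := by
    have h1 : Matrix.diagonal (fun i => z - l i) * (Matrix.replicateCol Unit
        (fun i => α i / (z - l i)) * Matrix.replicateRow Unit fun _ : Fin N => (1 : ℂ)) =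
        Matrix.of fun i _ => α i := by
      ext i j
      rw [Matrix.diagonal_mul]
      simp only [Matrix.mul_apply, Matrix.replicateCol_apply, Matrix.replicateRow_apply,
        Finset.univ_unique, Finset.sum_singleton, mul_one, Matrix.of_apply]
      rw [mul_div_cancel₀ _ (hz' i)]
    have h2 : bakerMat l ν * (Matrix.of fun i (_ : Fin N) => α i) = Matrix.of fun i _ => -ν i := by
      ext i j
      exact eq_neg_of_add_eq_zero_left (hα i)
    rw [mul_add, mul_one, h1, mul_add, h2]
    ext i j
    have hc : 1 + l j - l i ≠ 0 := fun h => hsep i j (by linear_combination -h)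
    have hd : (Matrix.diagonal fun i => z - l i) i j =
        (z - l i) * (1 : Matrix (Fin N) (Fin N) ℂ) i j := by
      simp [Matrix.diagonal_apply, Matrix.one_apply]
    simp only [bakerMat, mul_sub, sub_mul, one_mul, Matrix.sub_apply, Matrix.add_apply,
      Matrix.diagonal_mul, Matrix.mul_diagonal, Matrix.of_apply, cauchyMat]
    rw [hd]
    have hzi := hz' i
    field_simp
    ring
  have h := congr_arg Matrix.det key
  rw [Matrix.det_mul, Matrix.det_mul, Matrix.det_mul,
    Matrix.det_one_add_replicateCol_mul_replicateRow] at h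
  refine mul_left_cancel₀ hD (h.trans ?_)
  simp only [dotProduct, one_mul]
  ring

/-- As `matX l m` is `diag(μ) * cauchyMat l * diag(μ)`, the right hand factor `diag(μ)` can be
moved to the front under the determinant. -/
theorem det_one_sub_matX_mul (l m E : Fin N → ℂ) :
    (1 - matX l m * Matrix.diagonal E).det = (bakerMat l fun i => m i ^ 2 * E i).det := by
  have h1 : matX l m * Matrix.diagonal E =
      (Matrix.diagonal m * cauchyMat l) * Matrix.diagonal fun i => m i * E i := by
    ext i j
    simp only [Matrix.mul_diagonal, Matrix.diagonal_mul, matX, cauchyMat, Matrix.of_apply]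
    ring
  have h2 : (Matrix.diagonal fun i => m i * E i) * (Matrix.diagonal m * cauchyMat l) =
      Matrix.diagonal (fun i => m i ^ 2 * E i) * cauchyMat l := by
    rw [← mul_assoc, Matrix.diagonal_mul_diagonal]
    congr 2
    funext i
    ring
  rw [h1, Matrix.det_one_sub_mul_comm, h2, bakerMat]

theorem summable_times {R : ℝ} {t : ℕ+ → ℂ} (ht : t ∈ Times R) {w : ℂ} (hw : ‖w‖ < R) :
    Summable fun k : ℕ+ => t k * w ^ (k : ℕ) := by
  obtain ⟨ρ, hρ, hs⟩ := ht
  refine Summable.of_norm_bounded hs fun k => ?_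
  rw [norm_mul, norm_pow]
  gcongr
  exact (hw.trans hρ).le

theorem exp_tsum_eq_diagonal {R : ℝ} {l : Fin N → ℂ} (hl : IsPolar R l) {t : ℕ+ → ℂ}
    (ht : t ∈ Times R) :
    NormedSpace.exp (∑' k : ℕ+, t k • ((matZ l - 1) ^ (k : ℕ) - matZ l ^ (k : ℕ))) =
      Matrix.diagonal (flowFactor l t) := by
  have h1 : ∀ k : ℕ+, t k • ((matZ l - 1) ^ (k : ℕ) - matZ l ^ (k : ℕ)) =
      Matrix.diagonal fun i => t k * ((l i - 1) ^ (k : ℕ) - l i ^ (k : ℕ)) := by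
    intro k
    rw [matZ, ← Matrix.diagonal_one, Matrix.diagonal_sub, Matrix.diagonal_pow, Matrix.diagonal_pow,
      Matrix.diagonal_sub, ← Matrix.diagonal_smul]
    rfl
  have hs : ∀ i, HasSum (fun k : ℕ+ => t k * ((l i - 1) ^ (k : ℕ) - l i ^ (k : ℕ)))
      ((∑' k : ℕ+, t k * (l i - 1) ^ (k : ℕ)) - ∑' k : ℕ+, t k * l i ^ (k : ℕ)) := by
    intro i
    simp only [mul_sub]
    exact (summable_times ht (hl.lt' i)).hasSum.sub (summable_times ht (hl.lt i)).hasSum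
  simp only [h1]
  rw [← Matrix.diagonal_tsum, Matrix.exp_diagonal, (Pi.hasSum.2 hs).tsum_eq]
  congr 1
  funext i
  rw [Pi.coe_exp, ← Complex.exp_eq_exp_ℂ, Complex.exp_sub]
  rfl

/-- The tau function in terms of the linear system for the residues. -/
def tauDet (l m : Fin N → ℂ) (t : ℕ+ → ℂ) : ℂ :=
  (bakerMat l fun i => m i ^ 2 * flowFactor l t i).det

theorem det_eq_tauDet {R : ℝ} {l : Fin N → ℂ} (hl : IsPolar R l) (m : Fin N → ℂ) {t : ℕ+ → ℂ}
    (ht : t ∈ Times R) :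
    (1 - matX l m * NormedSpace.exp
      (∑' k : ℕ+, t k • ((matZ l - 1) ^ (k : ℕ) - matZ l ^ (k : ℕ)))).det = tauDet l m t := by
  rw [exp_tsum_eq_diagonal hl ht, det_one_sub_matX_mul, tauDet]

/-! ### Sato's formula -/

theorem hasSum_pow_div {x : ℂ} (hx : ‖x‖ < 1) :
    HasSum (fun k : ℕ+ => x ^ (k : ℕ) / (k : ℂ)) (-Complex.log (1 - x)) := by
  have h := Complex.hasSum_taylorSeries_neg_log' hx
  rw [← Equiv.pnatEquivNat.symm.hasSum_iff]
  convert! h using 2 with n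
  simp [Nat.succPNat]

theorem shift_mem_Times {R : ℝ} (hR : 0 < R) {t : ℕ+ → ℂ} (ht : t ∈ Times R) {z : ℂ}
    (hz : R < ‖z‖) : shift t z ∈ Times R := by
  obtain ⟨ρ, hρ, hs⟩ := ht
  obtain ⟨r, hr, hr'⟩ := exists_between (lt_min hρ hz)
  have hr0 : 0 < r := hR.trans hr
  have hz0 : 0 < ‖z‖ := hR.trans hz
  have h1 : Summable fun k : ℕ+ => (r / ‖z‖) ^ (k : ℕ) :=
    (summable_geometric_of_lt_one (by positivity)
      ((div_lt_one hz0).2 (hr'.trans_le (min_le_right _ _)))).comp_injective PNat.coe_injective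
  refine ⟨r, hr, Summable.of_nonneg_of_le (fun k => by positivity) (fun k => ?_) (hs.add h1)⟩
  have hk : (1 : ℝ) ≤ (k : ℕ) := by exact_mod_cast k.pos
  calc ‖shift t z k‖ * r ^ (k : ℕ)
      ≤ (‖t k‖ + ‖1 / ((k : ℂ) * z ^ (k : ℕ))‖) * r ^ (k : ℕ) := by
        gcongr
        exact norm_sub_le _ _
    _ ≤ (‖t k‖ + 1 / ‖z‖ ^ (k : ℕ)) * r ^ (k : ℕ) := by
        gcongr
        rw [norm_div, norm_one, norm_mul, norm_pow, Complex.norm_natCast]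
        gcongr
        exact le_mul_of_one_le_left (by positivity) hk
    _ = ‖t k‖ * r ^ (k : ℕ) + (r / ‖z‖) ^ (k : ℕ) := by
        rw [add_mul, div_pow, one_div_mul_eq_div]
    _ ≤ _ := by
        gcongr
        exact (hr'.trans_le (min_le_left _ _)).le

theorem expFlow_shift {R : ℝ} {t : ℕ+ → ℂ} (ht : t ∈ Times R) {w z : ℂ} (hw : ‖w‖ < R)
    (hz : R < ‖z‖) : expFlow (shift t z) w = expFlow t w * (1 - w / z) := by
  have hlt : ‖w / z‖ < 1 := by
    rw [norm_div]
    exact (div_lt_one ((norm_nonneg w).trans_lt (hw.trans hz))).2 (hw.trans hz)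
  have hne : 1 - w / z ≠ 0 := by
    intro h
    rw [sub_eq_zero] at h
    rw [← h, norm_one] at hlt
    exact lt_irrefl _ hlt
  have h := (summable_times ht hw).hasSum.sub (hasSum_pow_div hlt)
  have h1 : (fun k : ℕ+ => t k * w ^ (k : ℕ) - (w / z) ^ (k : ℕ) / (k : ℂ)) =
      fun k : ℕ+ => shift t z k * w ^ (k : ℕ) := by
    funext k
    rw [shift, sub_mul, div_pow, one_div_mul_eq_div, div_div, mul_comm (z ^ (k : ℕ))]
  rw [h1, sub_neg_eq_add] at h
  rw [expFlow, h.tsum_eq, Complex.exp_add, Complex.exp_log hne, expFlow]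

theorem flowFactor_shift {R : ℝ} {l : Fin N → ℂ} (hl : IsPolar R l) {t : ℕ+ → ℂ}
    (ht : t ∈ Times R) {z : ℂ} (hz : R < ‖z‖) (i : Fin N) :
    flowFactor l (shift t z) i = flowFactor l t i * (1 + 1 / (z - l i)) := by
  have hz0 : z ≠ 0 := norm_pos_iff.1 (hl.pos.trans hz)
  have hzi : z - l i ≠ 0 := by
    intro h
    rw [sub_eq_zero] at h
    rw [h] at hz
    exact lt_asymm hz (hl.lt i)
  have h1 := expFlow_ne_zero t (l i)
  have h2 : 1 - l i / z ≠ 0 := by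
    rw [one_sub_div hz0]
    exact div_ne_zero hzi hz0
  rw [flowFactor, flowFactor, expFlow_shift ht (hl.lt' i) hz, expFlow_shift ht (hl.lt i) hz]
  rw [one_sub_div hz0, one_sub_div hz0]
  field_simp
  ring

theorem outerValue_eq {R : ℝ} {l : Fin N → ℂ} (hl : IsPolar R l) (α : Fin N → ℂ) {z : ℂ}
    (hz : R < ‖z‖) :
    outerValue R (fourierLp 2 0 + ∑ j, α j • pole R (l j)) z = 1 + ∑ j, α j / (z - l j) := by
  have hz0 : z ≠ 0 := norm_pos_iff.1 (hl.pos.trans hz)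
  have hR0 : (R : ℂ) ≠ 0 := by exact_mod_cast hl.pos.ne'
  have hco : ∀ (j : Fin N) (n : ℕ), inner ℂ (fourierLp 2 (-((n : ℤ) + 1)) : H) (pole R (l j)) =
      l j ^ n / (R : ℂ) ^ (n + 1) := by
    intro j n
    have h := (innerSL ℂ (fourierLp 2 (-((n : ℤ) + 1)) : H)).hasSum (hasSum_pole hl.pos (hl.lt j))
    simp only [map_smul, innerSL_apply_apply, inner_fourierLp, smul_eq_mul] at h
    have h2 := hasSum_single (f := fun k : ℕ => l j ^ k / (R : ℂ) ^ (k + 1) *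
      if -((n : ℤ) + 1) = -((k : ℤ) + 1) then (1 : ℂ) else 0) n (fun b hb => by
        have : -((n : ℤ) + 1) ≠ -((b : ℤ) + 1) := by omega
        rw [if_neg this, mul_zero])
    rw [h.unique h2, if_pos rfl, mul_one]
  have hco0 : ∀ j : Fin N, inner ℂ (fourierLp 2 0 : H) (pole R (l j)) = 0 := by
    intro j
    rw [← fourierCoeff_eq_inner]
    exact pole_mem_HMinus hl.pos (hl.lt j) 0 (by simp)
  have hg : ∀ j, HasSum (fun n : ℕ => l j ^ n / (R : ℂ) ^ (n + 1) * ((R : ℂ) / z) ^ (n + 1))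
      (1 / (z - l j)) := by
    intro j
    have hlt : ‖l j / z‖ < 1 := by
      rw [norm_div]
      exact (div_lt_one (hl.pos.trans hz)).2 ((hl.lt j).trans hz)
    have hzi : z - l j ≠ 0 := by
      intro h
      rw [sub_eq_zero] at h
      rw [h] at hz
      exact lt_asymm hz (hl.lt j)
    convert! (hasSum_geometric_of_norm_lt_one hlt).mul_right z⁻¹ using 1
    · funext n
      rw [div_pow, div_pow, pow_succ z]
      field_simp
    · rw [one_sub_div hz0]
      field_simp
  set f : H := fourierLp 2 0 + ∑ j, α j • pole R (l j) with hf
  have hin : ∀ g : H, inner ℂ g f = inner ℂ g (fourierLp 2 0 : H) +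
      ∑ j, α j * inner ℂ g (pole R (l j)) := by
    intro g
    rw [hf, inner_add_right, inner_sum]
    simp only [inner_smul_right]
  have h0 : fourierCoeff (f : UnitAddCircle → ℂ) (-((0 : ℕ) : ℤ)) * ((R : ℂ) / z) ^ 0 = 1 := by
    rw [fourierCoeff_eq_inner, Nat.cast_zero, neg_zero, hin, inner_fourierLp]
    simp [hco0]
  have h1 : HasSum (fun n : ℕ => fourierCoeff (f : UnitAddCircle → ℂ) (-((n + 1 : ℕ) : ℤ)) *
      ((R : ℂ) / z) ^ (n + 1)) (∑ j, α j / (z - l j)) := by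
    convert! hasSum_sum fun j (_ : j ∈ Finset.univ) => (hg j).mul_left (α j) using 1
    · funext n
      rw [fourierCoeff_eq_inner, Nat.cast_succ, hin, inner_fourierLp, if_neg (by omega), zero_add,
        Finset.sum_mul]
      simp only [hco, mul_assoc]
    · simp only [mul_one_div]
  have h2 := (hasSum_nat_add_iff (f := fun n : ℕ => fourierCoeff (f : UnitAddCircle → ℂ)
    (-(n : ℤ)) * ((R : ℂ) / z) ^ n) 1).1 h1
  rw [Finset.sum_range_one, h0, add_comm] at h2
  exact h2.tsum_eq

/-- Sato's formula for the determinant, without division. -/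
theorem outerValue_bakerAkhiezer {R : ℝ} {l : Fin N → ℂ} (hl : IsPolar R l) (m : Fin N → ℂ)
    {t : ℕ+ → ℂ} (ht : t ∈ Times R) {f : H} (hf : IsReducedBakerAkhiezer R (WSpace R l m) t f)
    {z : ℂ} (hz : R < ‖z‖) : tauDet l m (shift t z) = tauDet l m t * outerValue R f z := by
  obtain ⟨h1, h2⟩ := hf
  rw [WSpace_eq_polarSpace hl, flow_polarSpace hl _ ht] at h1
  obtain ⟨p, hp, α, rfl, hα⟩ := exists_of_mem_polarSpace hl h1
  rw [proj_add_sum hl hp] at h2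
  have h2' : p = fourierLp 2 0 := h2
  subst h2'
  have hz' : ∀ i, z ≠ l i := by
    rintro i rfl
    exact lt_asymm hz (hl.lt i)
  have hα' : ∀ i, (bakerMat l fun i => m i ^ 2 * flowFactor l t i).mulVec α i +
      m i ^ 2 * flowFactor l t i = 0 := by
    intro i
    have h := hα i
    rw [evalAt_fourierLp (hl.lt' i)] at h
    simpa using h
  rw [outerValue_eq hl α hz, tauDet, tauDet, ← det_bakerMat_shift hl.sep hz' hα']
  congr 2
  funext i
  rw [flowFactor_shift hl ht hz, mul_assoc]

theorem transverse_flow_iff {R : ℝ} {l : Fin N → ℂ} (hl : IsPolar R l) (m : Fin N → ℂ)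
    {t : ℕ+ → ℂ} (ht : t ∈ Times R) :
    Transverse (flow R t (WSpace R l m)) ↔ tauDet l m t ≠ 0 := by
  rw [WSpace_eq_polarSpace hl, flow_polarSpace hl _ ht, transverse_polarSpace_iff hl, tauDet]

theorem exists_isReducedBakerAkhiezer {R : ℝ} {W : Submodule ℂ H} {t : ℕ+ → ℂ}
    (h : Transverse (flow R t W)) : ∃ f, IsReducedBakerAkhiezer R W t f := by
  obtain ⟨f, hf⟩ := h.2 ⟨fourierLp 2 0, fourierLp_mem_spectralSubspace (le_refl (0 : ℤ))⟩
  exact ⟨f, f.2, congr_arg Subtype.val hf⟩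

/-! ### Holomorphy of the determinant in the times -/

/-- The times `tₖ = aₖ ρ⁻ᵏ` given by a point `a` of `ℓ¹`. -/
def toTimes (ρ : ℝ) (a : lp (fun _ : ℕ+ => ℂ) 1) : ℕ+ → ℂ := fun k => a k / (ρ : ℂ) ^ (k : ℕ)

theorem summable_norm_lp_one (a : lp (fun _ : ℕ+ => ℂ) 1) : Summable fun k => ‖a k‖ := by
  simpa using (memℓp_gen_iff (by simp)).1 (lp.memℓp a)

theorem norm_lp_one (a : lp (fun _ : ℕ+ => ℂ) 1) : ‖a‖ = ∑' k, ‖a k‖ := by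
  simpa using lp.norm_eq_tsum_rpow (by simp) a

theorem toTimes_mem_Times {R ρ : ℝ} (hR : 0 < R) (hρ : R < ρ) (a : lp (fun _ : ℕ+ => ℂ) 1) :
    toTimes ρ a ∈ Times R := by
  refine ⟨ρ, hρ, ?_⟩
  convert summable_norm_lp_one a using 2 with k
  have hρ0 : 0 < ρ := hR.trans hρ
  rw [toTimes, norm_div, norm_pow, Complex.norm_real, Real.norm_of_nonneg hρ0.le,
    div_mul_cancel₀ _ (pow_ne_zero _ hρ0.ne')]

theorem exists_toTimes_eq {R : ℝ} (hR : 0 < R) {t : ℕ+ → ℂ} (ht : t ∈ Times R) :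
    ∃ ρ, R < ρ ∧ ∃ a, toTimes ρ a = t := by
  obtain ⟨ρ, hρ, hs⟩ := ht
  have hρ0 : 0 < ρ := hR.trans hρ
  have hρ1 : (ρ : ℂ) ≠ 0 := by exact_mod_cast hρ0.ne'
  refine ⟨ρ, hρ, ⟨fun k => t k * (ρ : ℂ) ^ (k : ℕ), memℓp_gen ?_⟩, ?_⟩
  · simpa [abs_of_pos hρ0] using hs
  · funext k
    exact mul_div_cancel_right₀ _ (pow_ne_zero _ hρ1)

/-- The functional `a ↦ ∑ aₖ cₖ` on `ℓ¹`, for a sequence `c` bounded by `1`. -/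
def pairing (c : ℕ+ → ℂ) (hc : ∀ k, ‖c k‖ ≤ 1) : lp (fun _ : ℕ+ => ℂ) 1 →L[ℂ] ℂ :=
  have hs : ∀ a : lp (fun _ : ℕ+ => ℂ) 1, Summable fun k => ‖a k * c k‖ := fun a =>
    Summable.of_nonneg_of_le (fun _ => norm_nonneg _) (fun k => by
      rw [norm_mul]
      exact mul_le_of_le_one_right (norm_nonneg _) (hc k)) (summable_norm_lp_one a)
  LinearMap.mkContinuous
    { toFun := fun a => ∑' k, a k * c k
      map_add' := fun a b => by
        rw [← (hs a).of_norm.tsum_add (hs b).of_norm]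
        simp only [lp.coeFn_add, Pi.add_apply, add_mul]
      map_smul' := fun r a => by
        simp only [lp.coeFn_smul, Pi.smul_apply, smul_eq_mul, mul_assoc, tsum_mul_left,
          RingHom.id_apply] } 1 (fun a => by
      rw [one_mul, norm_lp_one]
      refine (norm_tsum_le_tsum_norm (hs a)).trans ((hs a).tsum_le_tsum (fun k => ?_)
        (summable_norm_lp_one a))
      rw [norm_mul]
      exact mul_le_of_le_one_right (norm_nonneg _) (hc k))

theorem differentiable_expFlow_toTimes {ρ : ℝ} {w : ℂ} (hw : ‖w‖ < ρ) :
    Differentiable ℂ fun a => expFlow (toTimes ρ a) w := by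
  have hρ : 0 < ρ := (norm_nonneg w).trans_lt hw
  have hc : ∀ k : ℕ+, ‖(w / ρ) ^ (k : ℕ)‖ ≤ 1 := fun k => by
    rw [norm_pow]
    exact pow_le_one₀ (norm_nonneg _) (norm_div_ofReal_lt_one hw).le
  have h : (fun a => expFlow (toTimes ρ a) w) =
      fun a => Complex.exp (pairing (fun k : ℕ+ => (w / ρ) ^ (k : ℕ)) hc a) := by
    funext a
    refine congr_arg Complex.exp (tsum_congr fun k => ?_)
    change a k / (ρ : ℂ) ^ (k : ℕ) * w ^ (k : ℕ) = a k * (w / ρ) ^ (k : ℕ)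
    rw [div_pow, div_mul_eq_mul_div, mul_div_assoc]
  rw [h]
  exact (ContinuousLinearMap.differentiable _).cexp

theorem differentiable_det {E : Type*} [NormedAddCommGroup E] [NormedSpace ℂ E]
    {M : E → Matrix (Fin N) (Fin N) ℂ} (hM : ∀ i j, Differentiable ℂ fun a => M a i j) :
    Differentiable ℂ fun a => (M a).det := by
  simp only [Matrix.det_apply']
  refine Differentiable.fun_sum fun σ _ => Differentiable.const_mul ?_ _
  have : ∀ s : Finset (Fin N), Differentiable ℂ fun a => ∏ i ∈ s, M a (σ i) i := by
    intro s
    induction s using Finset.induction_on with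
    | empty => simp
    | insert i s hi ih =>
      simp only [Finset.prod_insert hi]
      exact (hM _ _).mul ih
  exact this _

theorem differentiable_tauDet {R ρ : ℝ} {l : Fin N → ℂ} (hl : IsPolar R l) (m : Fin N → ℂ)
    (hρ : R < ρ) : Differentiable ℂ fun a => tauDet l m (toTimes ρ a) := by
  refine differentiable_det fun i j => ?_
  simp only [bakerMat, Matrix.sub_apply, Matrix.diagonal_mul, flowFactor, div_eq_mul_inv]
  have h1 := differentiable_expFlow_toTimes ((hl.lt' i).trans hρ)
  have h2 := differentiable_expFlow_toTimes ((hl.lt i).trans hρ)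
  exact (differentiable_const _).sub (((h1.mul (h2.inv fun a => expFlow_ne_zero _ _)).const_mul
    _).mul_const _)

/-- The times `(s, 0, 0, …)`. -/
def firstTime (s : ℂ) : ℕ+ → ℂ := Pi.single 1 s

theorem firstTime_mem_Times (R : ℝ) (s : ℂ) : firstTime s ∈ Times R := by
  refine ⟨R + 1, lt_add_one R, summable_of_ne_finset_zero (s := {1}) fun k hk => ?_⟩
  rw [firstTime, Pi.single_eq_of_ne (by simpa using hk), norm_zero, zero_mul]

theorem flowFactor_firstTime (l : Fin N → ℂ) (s : ℂ) (i : Fin N) :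
    flowFactor l (firstTime s) i = Complex.exp (-s) := by
  have h : ∀ w, expFlow (firstTime s) w = Complex.exp (s * w) := by
    intro w
    rw [expFlow, tsum_eq_single 1 fun k hk => by rw [firstTime, Pi.single_eq_of_ne hk, zero_mul]]
    simp [firstTime]
  rw [flowFactor, h, h, ← Complex.exp_sub]
  congr 1
  ring

/-- The determinant tends to `1` at the times `(s, 0, 0, …)` as `s → ∞`, hence does not vanish
identically. -/
theorem exists_tauDet_ne_zero (l m : Fin N → ℂ) : ∃ s, tauDet l m (firstTime s) ≠ 0 := by
  have hd : Differentiable ℂ fun x : ℂ => (bakerMat l fun i => m i ^ 2 * x).det := by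
    refine differentiable_det fun i j => ?_
    simp only [bakerMat, Matrix.sub_apply, Matrix.diagonal_mul]
    fun_prop
  have h0 : (bakerMat l fun i => m i ^ 2 * 0).det = 1 := by
    simp [bakerMat]
  have h1 : ∀ᶠ x : ℂ in nhds 0, (bakerMat l fun i => m i ^ 2 * x).det ≠ 0 :=
    hd.continuous.continuousAt.eventually_ne (by rw [h0]; exact one_ne_zero)
  obtain ⟨ε, hε, hε'⟩ := Metric.eventually_nhds_iff.1 h1
  obtain ⟨x, hx, hx'⟩ := exists_between hε
  refine ⟨-Complex.log x, ?_⟩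
  have hx0 : (x : ℂ) ≠ 0 := by exact_mod_cast hx.ne'
  simp only [tauDet, flowFactor_firstTime, neg_neg, Complex.exp_log hx0]
  refine hε' ?_
  rwa [dist_zero_right, Complex.norm_real, Real.norm_of_nonneg hx.le]

/-! ### Uniqueness of the tau function -/

/-- The point `(u, u² / 2, u³ / 3, …)` of `ℓ¹`. -/
def bracket (u : ℂ) : lp (fun _ : ℕ+ => ℂ) 1 :=
  ∑' n : ℕ, (u ^ (n + 1) / ((n : ℂ) + 1)) • lp.single 1 n.succPNat (1 : ℂ)

theorem norm_single_one (k : ℕ+) :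
    ‖(lp.single 1 k (1 : ℂ) : lp (fun _ : ℕ+ => ℂ) 1)‖ = 1 := by
  rw [lp.norm_single (by norm_num), norm_one]

theorem summable_bracketDeriv {u : ℂ} (hu : ‖u‖ < 1) : Summable fun n : ℕ =>
    u ^ n • (lp.single 1 n.succPNat (1 : ℂ) : lp (fun _ : ℕ+ => ℂ) 1) := by
  refine Summable.of_norm ?_
  simp only [norm_smul, norm_single_one, mul_one, norm_pow]
  exact summable_geometric_of_lt_one (norm_nonneg _) hu

theorem summable_bracket {u : ℂ} (hu : ‖u‖ < 1) : Summable fun n : ℕ =>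
    (u ^ (n + 1) / ((n : ℂ) + 1)) •
      (lp.single 1 n.succPNat (1 : ℂ) : lp (fun _ : ℕ+ => ℂ) 1) := by
  refine Summable.of_norm ?_
  simp only [norm_smul, norm_single_one, mul_one]
  exact (Complex.hasSum_taylorSeries_neg_log' hu).summable.norm

theorem hasDerivAt_bracket {u : ℂ} (hu : ‖u‖ < 1) : HasDerivAt bracket
    (∑' n : ℕ, u ^ n • (lp.single 1 n.succPNat (1 : ℂ) : lp (fun _ : ℕ+ => ℂ) 1)) u := by
  obtain ⟨r, hr, hr1⟩ := exists_between hu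
  refine hasDerivAt_tsum_of_isPreconnected (u := fun n : ℕ => r ^ n) (t := Metric.ball 0 r)
    (g := fun (n : ℕ) (u : ℂ) => (u ^ (n + 1) / ((n : ℂ) + 1)) •
      (lp.single 1 n.succPNat (1 : ℂ) : lp (fun _ : ℕ+ => ℂ) 1))
    (g' := fun (n : ℕ) (u : ℂ) => u ^ n •
      (lp.single 1 n.succPNat (1 : ℂ) : lp (fun _ : ℕ+ => ℂ) 1))
    (summable_geometric_of_lt_one ((norm_nonneg u).trans hr.le) hr1) Metric.isOpen_ball
    (convex_ball 0 r).isPreconnected (fun n y _ => ?_) (fun n y hy => ?_)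
    (mem_ball_zero_iff.2 hr) (summable_bracket hu) (mem_ball_zero_iff.2 hr)
  · have h1 := ((hasDerivAt_pow (n + 1) y).div_const ((n : ℂ) + 1)).smul_const
      (lp.single 1 n.succPNat (1 : ℂ) : lp (fun _ : ℕ+ => ℂ) 1)
    convert! h1 using 2
    have : (n : ℂ) + 1 ≠ 0 := by exact_mod_cast n.succ_ne_zero
    push_cast
    field_simp
  · rw [mem_ball_zero_iff] at hy
    rw [norm_smul, norm_single_one, mul_one, norm_pow]
    gcongr

theorem bracket_apply {u : ℂ} (hu : ‖u‖ < 1) (k : ℕ+) :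
    bracket u k = u ^ (k : ℕ) / (k : ℂ) := by
  have h := (lp.evalCLM ℂ (fun _ : ℕ+ => ℂ) 1 k).hasSum (summable_bracket hu).hasSum
  have h2 := hasSum_single (f := fun n : ℕ => u ^ (n + 1) / ((n : ℂ) + 1) *
    (Pi.single n.succPNat (1 : ℂ) : ℕ+ → ℂ) k) k.natPred (fun n hn => by
      rw [Pi.single_eq_of_ne, mul_zero]
      rintro rfl
      exact hn (Nat.natPred_succPNat n).symm)
  have h1 : ((k.natPred : ℕ) : ℂ) + 1 = (k : ℂ) := by
    exact_mod_cast congr_arg (Nat.cast (R := ℂ)) (PNat.natPred_add_one k)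
  refine (h.unique h2).trans ?_
  rw [h1, PNat.natPred_add_one, PNat.succPNat_natPred, Pi.single_eq_same, mul_one]

theorem bracket_zero : bracket 0 = 0 := by
  refine lp.ext (funext fun k => ?_)
  rw [bracket_apply (by simp), zero_pow k.ne_zero, zero_div]
  rfl

theorem toTimes_sub_bracket {ρ : ℝ} (hρ : 0 < ρ) (a : lp (fun _ : ℕ+ => ℂ) 1) {u : ℂ}
    (hu : ‖u‖ < 1) : toTimes ρ (a - bracket u) = shift (toTimes ρ a) (ρ / u) := by
  funext k
  have hρ0 : (ρ : ℂ) ^ (k : ℕ) ≠ 0 := pow_ne_zero _ (by exact_mod_cast hρ.ne')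
  rw [toTimes, lp.coeFn_sub, Pi.sub_apply, bracket_apply hu, sub_div, shift, toTimes, div_pow,
    div_div, mul_div_assoc', one_div_div]

theorem eq_zero_of_eventually_hasSum_zero {c : ℕ → ℂ}
    (h : ∀ᶠ u : ℂ in nhds 0, HasSum (fun n => u ^ n * c n) 0) (n : ℕ) : c n = 0 := by
  have h1 : HasFPowerSeriesAt (0 : ℂ → ℂ) (FormalMultilinearSeries.ofScalars ℂ c) 0 := by
    rw [hasFPowerSeriesAt_iff]
    filter_upwards [h] with u hu
    simpa [FormalMultilinearSeries.coeff_ofScalars] using hu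
  rw [← FormalMultilinearSeries.coeff_ofScalars (𝕜 := ℂ) (p := c) (n := n), h1.eq_zero]
  rfl

/-- A continuous functional on `ℓ¹` that vanishes on the vectors `(1, u, u², …)` with `u` small is
zero. -/
theorem eq_zero_of_eventually_bracketDeriv (L : lp (fun _ : ℕ+ => ℂ) 1 →L[ℂ] ℂ)
    (h : ∀ᶠ u : ℂ in nhds 0, L (∑' n : ℕ, u ^ n • lp.single 1 n.succPNat (1 : ℂ)) = 0) :
    L = 0 := by
  have h1 : ∀ n : ℕ, L (lp.single 1 n.succPNat (1 : ℂ)) = 0 := by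
    refine eq_zero_of_eventually_hasSum_zero ?_
    filter_upwards [h, Metric.ball_mem_nhds (0 : ℂ) one_pos] with u hu hu1
    have h2 := L.hasSum (summable_bracketDeriv (mem_ball_zero_iff.1 hu1)).hasSum
    rw [hu] at h2
    simpa only [map_smul, smul_eq_mul] using h2
  ext a
  refine (L.hasSum (lp.hasSum_single (by simp) a)).unique ?_
  convert! hasSum_zero using 2 with k
  have h2 := h1 k.natPred
  rw [PNat.succPNat_natPred] at h2
  have h3 : (lp.single 1 k (a k) : lp (fun _ : ℕ+ => ℂ) 1) = a k • lp.single 1 k (1 : ℂ) := by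
    rw [← lp.single_smul, smul_eq_mul, mul_one]
  rw [h3, map_smul, h2, smul_zero]

/-- If the ratio of `g` and `g₀` is invariant under translation by `-(u, u² / 2, u³ / 3, …)` for all
small `u`, then `g` and `g₀` have the same logarithmic derivative. -/
theorem fderiv_eq_of_bracket {g g₀ : lp (fun _ : ℕ+ => ℂ) 1 → ℂ} (hg : Differentiable ℂ g)
    (hg₀ : Differentiable ℂ g₀)
    (h : ∀ a, g₀ a ≠ 0 → ∀ u, ‖u‖ < 1 → g (a - bracket u) * g₀ a = g₀ (a - bracket u) * g a)
    {a : lp (fun _ : ℕ+ => ℂ) 1} (ha : g₀ a ≠ 0) :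
    g₀ a • fderiv ℂ g a = g a • fderiv ℂ g₀ a := by
  rw [← sub_eq_zero]
  refine eq_zero_of_eventually_bracketDeriv _ ?_
  have hb : ContinuousAt bracket 0 := (hasDerivAt_bracket (by simp)).continuousAt
  have hc : ContinuousAt (fun u => g₀ (a + bracket u)) 0 :=
    hg₀.continuous.continuousAt.comp (continuousAt_const.add hb)
  have hne : ∀ᶠ u : ℂ in nhds 0, g₀ (a + bracket u) ≠ 0 :=
    hc.eventually_ne (by rwa [bracket_zero, add_zero])
  filter_upwards [hne, Metric.ball_mem_nhds (0 : ℂ) one_pos] with u hu hu1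
  have hu1' := mem_ball_zero_iff.1 hu1
  set b := a + bracket u with hbdef
  set v := ∑' n : ℕ, u ^ n • (lp.single 1 n.succPNat (1 : ℂ) : lp (fun _ : ℕ+ => ℂ) 1)
  have hab : b - bracket u = a := add_sub_cancel_right _ _
  have hd : ∀ G : lp (fun _ : ℕ+ => ℂ) 1 → ℂ, Differentiable ℂ G →
      HasDerivAt (fun x => G (b - bracket x)) (fderiv ℂ G a (-v)) u := by
    intro G hG
    have h1 : HasFDerivAt G (fderiv ℂ G a) (b - bracket u) := by
      rw [hab]
      exact (hG a).hasFDerivAt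
    exact h1.comp_hasDerivAt u ((hasDerivAt_bracket hu1').const_sub b)
  have h1 := (hd g hg).mul_const (g₀ b)
  have h2 := (hd g₀ hg₀).mul_const (g b)
  have h3 : (fun x => g (b - bracket x) * g₀ b) =ᶠ[nhds u]
      fun x => g₀ (b - bracket x) * g b := by
    filter_upwards [Metric.isOpen_ball.mem_nhds hu1] with x hx
    exact h b hu x (mem_ball_zero_iff.1 hx)
  have h4 := h1.unique (h2.congr_of_eventuallyEq h3)
  have h5 := h b hu u hu1'
  rw [hab] at h5
  simp only [map_neg] at h4
  refine mul_left_cancel₀ hu ?_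
  simp only [sub_apply, smul_apply, smul_eq_mul]
  linear_combination -(g₀ a) * h4 - fderiv ℂ g₀ a v * h5

/-- Two entire functions of one variable with the same logarithmic derivative are proportional. -/
theorem mul_eq_mul_of_deriv {f f₀ : ℂ → ℂ} (hf : Differentiable ℂ f) (hf₀ : Differentiable ℂ f₀)
    (h0 : f₀ 0 ≠ 0) (h : ∀ x, f₀ x ≠ 0 → f₀ x * deriv f x = f x * deriv f₀ x) (x : ℂ) :
    f x * f₀ 0 = f 0 * f₀ x := by
  obtain ⟨r, hr, hr'⟩ := Metric.eventually_nhds_iff_ball.1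
    (hf₀.continuous.continuousAt.eventually_ne h0)
  have h1 : ∀ y ∈ Metric.ball (0 : ℂ) r, f y / f₀ y = f 0 / f₀ 0 := by
    intro y hy
    refine Metric.isOpen_ball.is_const_of_deriv_eq_zero (convex_ball _ _).isPreconnected
      (f := fun y => f y / f₀ y) ?_ (fun z hz => ?_) hy (Metric.mem_ball_self hr)
    · exact hf.differentiableOn.div hf₀.differentiableOn hr'
    · refine ((hf z).hasDerivAt.div (hf₀ z).hasDerivAt (hr' z hz)).deriv.trans ?_
      rw [mul_comm (deriv f z), h z (hr' z hz), sub_self, zero_div]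
      rfl
  have h2 : (fun y => f y * f₀ 0) =ᶠ[nhds 0] fun y => f 0 * f₀ y := by
    filter_upwards [Metric.ball_mem_nhds (0 : ℂ) hr] with y hy
    exact (div_eq_div_iff (hr' y hy) h0).1 (h1 y hy)
  have h3 := AnalyticOnNhd.eq_of_eventuallyEq
    (Complex.analyticOnNhd_univ_iff_differentiable.2 (hf.mul_const (f₀ 0)))
    (Complex.analyticOnNhd_univ_iff_differentiable.2 (hf₀.const_mul (f 0))) h2
  exact congr_fun h3 x

/-- In the situation of `fderiv_eq_of_bracket`, the functions `g` and `g₀` are proportional: they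
are proportional on every complex line through a point at which `g₀` does not vanish. -/
theorem mul_eq_mul_of_bracket {g g₀ : lp (fun _ : ℕ+ => ℂ) 1 → ℂ} (hg : Differentiable ℂ g)
    (hg₀ : Differentiable ℂ g₀)
    (h : ∀ a, g₀ a ≠ 0 → ∀ u, ‖u‖ < 1 → g (a - bracket u) * g₀ a = g₀ (a - bracket u) * g a)
    {a : lp (fun _ : ℕ+ => ℂ) 1} (ha : g₀ a ≠ 0) (b : lp (fun _ : ℕ+ => ℂ) 1) :
    g b * g₀ a = g a * g₀ b := by
  have hline : ∀ x : ℂ, HasDerivAt (fun x : ℂ => a + x • (b - a)) (b - a) x := fun x => by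
    simpa using ((hasDerivAt_id x).smul_const (b - a)).const_add a
  have hd : ∀ G : lp (fun _ : ℕ+ => ℂ) 1 → ℂ, Differentiable ℂ G → ∀ x : ℂ,
      HasDerivAt (fun x : ℂ => G (a + x • (b - a)))
        (fderiv ℂ G (a + x • (b - a)) (b - a)) x := fun G hG x =>
    (hG _).hasFDerivAt.comp_hasDerivAt x (hline x)
  have h1 := mul_eq_mul_of_deriv (f := fun x : ℂ => g (a + x • (b - a)))
    (f₀ := fun x : ℂ => g₀ (a + x • (b - a))) (fun x => (hd g hg x).differentiableAt)
    (fun x => (hd g₀ hg₀ x).differentiableAt) (by simpa using ha) (fun x hx => by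
      rw [(hd g hg x).deriv, (hd g₀ hg₀ x).deriv]
      exact DFunLike.congr_fun (fderiv_eq_of_bracket hg hg₀ h hx) (b - a)) 1
  simpa using h1

theorem isTauFunction_iff {R : ℝ} {l : Fin N → ℂ} (hl : IsPolar R l) (m : Fin N → ℂ)
    (τ : (ℕ+ → ℂ) → ℂ) : IsTauFunction R (WSpace R l m) τ ↔
      ∃ c : ℂ, c ≠ 0 ∧ ∀ t ∈ Times R, τ t = c * tauDet l m t := by
  constructor
  · rintro ⟨hol, sato⟩
    obtain ⟨s, hs⟩ := exists_tauDet_ne_zero l m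
    have hs0 := firstTime_mem_Times R s
    have hτ := (sato _ hs0 ((transverse_flow_iff hl m hs0).2 hs)).1
    refine ⟨τ (firstTime s) / tauDet l m (firstTime s), div_ne_zero hτ hs, fun t ht => ?_⟩
    obtain ⟨ρ, hρ, b, rfl⟩ := exists_toTimes_eq hl.pos ht
    have hρ0 : 0 < ρ := hl.pos.trans hρ
    have ha : toTimes ρ (lp.single 1 1 (s * ρ)) = firstTime s := by
      funext k
      by_cases hk : k = 1
      · subst hk
        have : (ρ : ℂ) ≠ 0 := by exact_mod_cast hρ0.ne'
        simp [toTimes, firstTime, this]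
      · simp [toTimes, firstTime, hk]
    have hbr : ∀ a, tauDet l m (toTimes ρ a) ≠ 0 → ∀ u : ℂ, ‖u‖ < 1 →
        τ (toTimes ρ (a - bracket u)) * tauDet l m (toTimes ρ a) =
          tauDet l m (toTimes ρ (a - bracket u)) * τ (toTimes ρ a) := by
      intro a ha0 u hu
      by_cases hu0 : u = 0
      · rw [hu0, bracket_zero, sub_zero, mul_comm]
      have hz : R < ‖(ρ : ℂ) / u‖ := by
        rw [norm_div, Complex.norm_real, Real.norm_of_nonneg hρ0.le]
        exact hρ.trans_le (le_div_self hρ0.le (norm_pos_iff.2 hu0) hu.le)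
      have hat := toTimes_mem_Times hl.pos hρ a
      have htr := (transverse_flow_iff hl m hat).2 ha0
      obtain ⟨f, hf⟩ := exists_isReducedBakerAkhiezer htr
      obtain ⟨hne, hsato⟩ := sato _ hat htr
      have h1 := hsato f hf _ hz
      rw [eq_div_iff hne] at h1
      rw [toTimes_sub_bracket hρ0 a hu, outerValue_bakerAkhiezer hl m hat hf hz, ← h1]
      ring
    have h1 := mul_eq_mul_of_bracket (hol ρ hρ) (differentiable_tauDet hl m hρ) hbr
      (a := lp.single 1 1 (s * ρ)) (by rwa [ha]) b
    change τ (toTimes ρ b) * tauDet l m (toTimes ρ _) = τ (toTimes ρ _) * _ at h1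
    rw [ha] at h1
    rw [div_mul_eq_mul_div, eq_div_iff hs]
    exact h1
  · rintro ⟨c, hc, h⟩
    refine ⟨fun ρ hρ => ?_, fun t ht htr => ?_⟩
    · have : (fun a : lp (fun _ : ℕ+ => ℂ) 1 => τ fun k => a k / (ρ : ℂ) ^ (k : ℕ)) =
          fun a => c * tauDet l m (toTimes ρ a) :=
        funext fun a => h _ (toTimes_mem_Times hl.pos hρ a)
      rw [this]
      exact (differentiable_tauDet hl m hρ).const_mul c
    · have h0 := (transverse_flow_iff hl m ht).1 htr
      refine ⟨by rw [h t ht]; exact mul_ne_zero hc h0, fun f hf z hz => ?_⟩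
      rw [h t ht, h _ (shift_mem_Times hl.pos ht hz), outerValue_bakerAkhiezer hl m ht hf hz,
        mul_div_mul_left _ _ hc, mul_div_cancel_left₀ _ h0]

end SegalWilson

end


open SegalWilson in
theorem proposition1 (R : ℝ) (hR : 0 < R) (N : ℕ) (l m : Fin N → ℂ)
    (hl : Function.Injective l) (hm : ∀ i, m i ≠ 0)
    (hl1 : ∀ i j, i ≠ j → l i - l j ≠ 1)
    (hin : ∀ i, ‖l i‖ < R) (hin1 : ∀ i, ‖l i - 1‖ < R) :
    MemGr (WSpace R l m) ∧
    ∀ τ : (ℕ+ → ℂ) → ℂ, IsTauFunction R (WSpace R l m) τ ↔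
      ∃ c : ℂ, c ≠ 0 ∧ ∀ t ∈ Times R,
        τ t = c * (1 - matX l m * NormedSpace.exp
          (∑' k : ℕ+, t k • ((matZ l - 1) ^ (k : ℕ) - matZ l ^ (k : ℕ)))).det := by
  have h : IsPolar R l := ⟨hR, hl, fun i j => by
    by_cases hij : i = j
    · simp [hij]
    · exact hl1 i j hij, hin, hin1⟩
  refine ⟨?_, fun τ => ?_⟩
  · rw [WSpace_eq_polarSpace h]
    exact memGr_polarSpace h fun i => pow_ne_zero 2 (hm i)
  · rw [isTauFunction_iff h]
    refine exists_congr fun c => and_congr_right fun _ => forall₂_congr fun t ht => ?_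
    rw [det_eq_tauDet h m ht]
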